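/- Let $A$ be a finite alphabet. A morphism $\sigma\colon A^*\to A^*$ is a \emph{substitution} if $\sigma(a)$ begins with $a$ for some letter $a\in A$ and $|\sigma^n(b)|\to\infty$ for every letter $b$. Its incidence matrix $M_\sigma$ has as entry $(i,j)$ the number of occurrences of $i$ in $\sigma(j)$, and $P_\sigma$ denotes the characteristic polynomial of $M_\sigma$. The substitution $\sigma$ is \emph{primitive} if some positive power of $M_\sigma$ has only positive entries, and \emph{proper} if all the words $\sigma(b)$, $b\in A$, start with the same letter and all of them end with the same letter (the first and last letters may differ). For a primitive substitution $\sigma$, let $\Omega_\sigma\subset A^{\mathbb Z}$ be the set of bi-infinite sequences each of whose finite factors occurs in $\sigma^n(b)$ for some $n\ge 0$ and $b\in A$, with the product topology and the shift $S$; $\sigma$ is \emph{aperiodic} if $\Omega_\sigma$ is infinite. A primitive substitution $\sigma$ is of \emph{Pisot type} if $P_\sigma$ has a real root $\beta>1$ and every other complex root $\beta'$ of $P_\sigma$ satisfies $0<|\beta'|<1$. It is of \emph{weakly irreducible Pisot type} if the dominant root of $P_\sigma$ (the root of strictly largest modulus) is a Pisot number $\beta$ (a real algebraic integer $>1$ whose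 other algebraic conjugates have modulus $<1$), all algebraic conjugates of $\beta$ are roots of $P_\sigma$, and every remaining root of $P_\sigma$ is $0$ or a root of unity. \textbf{Statement.} Let $\sigma$ be an aperiodic substitution of Pisot type. Then there is a proper primitive substitution $\xi$ on a finite alphabet, of weakly irreducible Pisot type, such that $(\Omega_\sigma,S)$ and $(\Omega_\xi,S)$ are conjugate, that is, there is a homeomorphism $\Omega_\sigma\to\Omega_\xi$ commuting with the shifts. -/

import Mathlib

namespace PisotSubst

open Filter SymbolicDynamics.FullShift

section Words

variable {A : Type*}

/-- The length-`n` factor `x i, x (i+1), …, x (i+n-1)` of a bi-infinite sequence `x`. -/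
def factor (x : ℤ → A) (i : ℤ) (n : ℕ) : List A :=
  List.ofFn fun k : Fin n => x (i + (k : ℕ))

/-- A morphism `σ : A* → A*` is a substitution if `σ(a)` begins with `a` for some letter `a` and
`|σⁿ(b)| → ∞` for every letter `b`. -/
def IsSubstitution (σ : Monoid.End (FreeMonoid A)) : Prop :=
  (∃ a : A, [a] <+: (σ (FreeMonoid.of a)).toList) ∧
    ∀ b : A, Tendsto (fun n : ℕ => ((σ ^ n) (FreeMonoid.of b)).length) atTop atTop

/-- All the words `σ(b)` start with the same letter. -/
def IsLeftProper (σ : Monoid.End (FreeMonoid A)) : Prop :=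
  ∃ a : A, ∀ b : A, [a] <+: (σ (FreeMonoid.of b)).toList

/-- All the words `σ(b)` end with the same letter. -/
def IsRightProper (σ : Monoid.End (FreeMonoid A)) : Prop :=
  ∃ a : A, ∀ b : A, [a] <:+ (σ (FreeMonoid.of b)).toList

def IsProper (σ : Monoid.End (FreeMonoid A)) : Prop :=
  IsLeftProper σ ∧ IsRightProper σ

/-- The language of `σ`: the words that occur in some `σⁿ(b)`. -/
def language (σ : Monoid.End (FreeMonoid A)) : Set (List A) :=
  {w | ∃ (n : ℕ) (b : A), w <:+: ((σ ^ n) (FreeMonoid.of b)).toList}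

/-- The incidence matrix: the entry `(i, j)` is the number of occurrences of `i` in `σ(j)`. -/
def incidenceMatrix [DecidableEq A] (σ : Monoid.End (FreeMonoid A)) : Matrix A A ℤ :=
  Matrix.of fun i j => ((σ (FreeMonoid.of j)).toList.count i : ℤ)

/-- A primitive substitution: some power of the incidence matrix is strictly positive. -/
def IsPrimitiveSubstitution [Fintype A] [DecidableEq A] (σ : Monoid.End (FreeMonoid A)) : Prop :=
  IsSubstitution σ ∧ (incidenceMatrix σ).IsPrimitive

/-- The characteristic polynomial of the incidence matrix. -/
noncomputable def charPoly [Fintype A] [DecidableEq A] (σ : Monoid.End (FreeMonoid A)) :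
    Polynomial ℤ :=
  (incidenceMatrix σ).charpoly

/-- Pisot type: the characteristic polynomial has a root `β > 1` and all its other complex roots
`z` satisfy `0 < |z| < 1`. -/
def IsPisotType [Fintype A] [DecidableEq A] (σ : Monoid.End (FreeMonoid A)) : Prop :=
  IsPrimitiveSubstitution σ ∧
    ∃ β : ℝ, 1 < β ∧ Polynomial.aeval (β : ℂ) (charPoly σ) = 0 ∧
      ∀ z : ℂ, Polynomial.aeval z (charPoly σ) = 0 → z ≠ (β : ℂ) → 0 < ‖z‖ ∧ ‖z‖ < 1

/-- A real algebraic integer greater than `1` whose other conjugates all have modulus less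
than `1`. -/
def IsPisotNumber (β : ℝ) : Prop :=
  1 < β ∧ IsIntegral ℤ β ∧
    ∀ z : ℂ, Polynomial.aeval z (minpoly ℚ β) = 0 → z ≠ (β : ℂ) → ‖z‖ < 1

/-- Weakly irreducible Pisot type: the dominant root of the characteristic polynomial is a Pisot
number `β`, the conjugates of `β` are roots, and any other root is `0` or a root of unity. -/
def IsWeaklyIrreduciblePisotType [Fintype A] [DecidableEq A]
    (σ : Monoid.End (FreeMonoid A)) : Prop :=
  IsPrimitiveSubstitution σ ∧
    ∃ β : ℝ, IsPisotNumber β ∧ Polynomial.aeval (β : ℂ) (charPoly σ) = 0 ∧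
      (∀ z : ℂ, Polynomial.aeval z (charPoly σ) = 0 → z ≠ (β : ℂ) → ‖z‖ < β) ∧
      (∀ z : ℂ, Polynomial.aeval z (minpoly ℚ β) = 0 → Polynomial.aeval z (charPoly σ) = 0) ∧
      ∀ z : ℂ, Polynomial.aeval z (charPoly σ) = 0 →
        Polynomial.aeval z (minpoly ℚ β) = 0 ∨ z = 0 ∨ ∃ n : ℕ, 0 < n ∧ z ^ n = 1

theorem factor_shift (g : ℤ) (x : ℤ → A) (i : ℤ) (n : ℕ) :
    factor (shift g x) i n = factor x (g + i) n := by
  simp [factor, add_assoc]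

theorem isClosed_factor_mem [TopologicalSpace A] [DiscreteTopology A] (i : ℤ) (n : ℕ)
    (L : Set (List A)) : IsClosed {x : ℤ → A | factor x i n ∈ L} := by
  have h : Continuous fun (x : ℤ → A) (k : Fin n) => x (i + (k : ℕ)) := by fun_prop
  exact (isClosed_discrete {f : Fin n → A | List.ofFn f ∈ L}).preimage h

end Words

section Subshifts

variable {A B : Type*} [TopologicalSpace A] [TopologicalSpace B]

/-- The subshift generated by `σ`: the bi-infinite sequences all of whose factors belong to the
language of `σ`. -/
def substSubshift [DiscreteTopology A] (σ : Monoid.End (FreeMonoid A)) : Subshift A ℤ where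
  carrier := {x | ∀ (i : ℤ) (n : ℕ), factor x i n ∈ language σ}
  isClosed := by
    simp only [Set.ofPred_forall]
    exact isClosed_iInter fun i => isClosed_iInter fun n => isClosed_factor_mem i n _
  mapsTo := by
    intro g x hx i n
    rw [factor_shift]
    exact hx _ _

/-- `σ` is aperiodic if its subshift is not finite. -/
def IsAperiodic [DiscreteTopology A] (σ : Monoid.End (FreeMonoid A)) : Prop :=
  (substSubshift σ).carrier.Infinite

/-- The shift transformation `(S x) n = x (n + 1)` restricted to a subshift. -/
def shiftMap (X : Subshift A ℤ) : X.carrier → X.carrier :=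
  (X.mapsTo 1).restrict

/-- Two subshifts are conjugate if some homeomorphism between them commutes with the shifts. -/
def Conjugate (X : Subshift A ℤ) (Y : Subshift B ℤ) : Prop :=
  ∃ φ : X.carrier ≃ₜ Y.carrier, ∀ x, φ (shiftMap X x) = shiftMap Y (φ x)

end Subshifts

end PisotSubst

/-! The conjugacy recodes a sequence of `Ω_σ` by cutting it at every occurrence of a suitable
two-letter word `ba`, between `b` and `a`. A power of `σ` has three properties (`CutsAt`): the image
of `a` begins with `a`, the image of `b` ends with `b`, and every image of a letter contains `ba`.
Passing to a power does not change the subshift. Write `σ` for this power. The words between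
consecutive cuts, the return words, are finite in number, and since `σ` preserves cuts it induces a
substitution `τ` on them. It is proper: every return word begins with `a` and ends with `b`, and the
images of these two letters already contain a cut.

The new alphabet consists of the positions in return words. `levels` writes a return word as the
list of its positions, and `group` distributes `τ²(r)` over the positions of `r`, in pieces that are
`τ`-images of nonempty words. Thus `group ∘ levels = τ²`, while `ξ = levels ∘ group` is proper and
primitive. Reading the letter at each position maps `Ω_ξ` to `Ω_σ`. This map is injective because
position `0` occurs exactly after a cut, which is visible in the image (`pos_eq_zero_iff`,
`eq_of_letter_eq`). It is surjective by compactness.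

For the spectrum, `ξ` and `τ²` have the same nonzero eigenvalues. An eigenvector of `τ²` either has
a nonzero image under the spelling matrix, and so gives an eigenvector of `σ²`, or lies in its
kernel. On words, the number of blocks of a given kind in `σⁿ(w)` is linear in the letter counts of
`w`, up to a sum over adjacent pairs with coefficients in `[-2, 2]`. On the kernel only the pair
terms survive. They take finitely many values as `n` varies, so two powers of `τ²` agree there and
the eigenvalue is a root of unity (`exists_pow_eq_on_ker`). A trace bound gives `ξ` an eigenvalue
outside the unit disc, which must be the Pisot root. -/

namespace PisotSubst

open Filter SymbolicDynamics.FullShift Polynomial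

/-! ### Cutting words at the occurrences of `ba` -/

section Blocks

variable {A : Type*}

/-- The relation between consecutive letters that do not form the word `ba`. -/
def NoCut (b a x y : A) : Prop := ¬(x = b ∧ y = a)

/-- Extended by the letters around it, a block of a word is a factor of the extended word. -/
theorem mem_chain_blocks {b a : A} {L : List (List A)} (hn : [] ∉ L)
    (hL : L.IsChain fun u v => u.getLast? = some b ∧ v.head? = some a)
    (hh : L.flatten.head? = some a) (hl : L.flatten.getLast? = some b) :
    ∀ m ∈ L, m.head? = some a ∧ m.getLast? = some b ∧
      (b :: m ++ [a]) <:+: (b :: L.flatten ++ [a]) := by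
  induction L with
  | nil => simp
  | cons m L ih =>
    have hm : m ≠ [] := by rintro rfl; simp at hn
    rcases L with _ | ⟨m', L⟩
    · simp_all
    · have hc := List.isChain_cons_cons.1 hL
      have hm' : m' ≠ [] := by rintro rfl; simp at hn
      have hh' : (m' :: L).flatten.head? = some a := by
        rw [List.flatten_cons, List.head?_append_of_ne_nil _ hm']; exact hc.1.2
      have hne : (m' :: L).flatten ≠ [] := by simp [hm']
      have hl' : (m' :: L).flatten.getLast? = some b := by
        rwa [List.flatten_cons, List.getLast?_append_of_ne_nil _ hne] at hl
      have ih := ih (fun h => hn (List.mem_cons_of_mem _ h)) hc.2 hh' hl'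
      obtain ⟨t, ht⟩ := List.head?_eq_some_iff.1 hh'
      obtain ⟨t', ht'⟩ := List.getLast?_eq_some_iff.1 hc.1.1
      intro x hx
      rcases List.mem_cons.1 hx with rfl | hx
      · refine ⟨?_, hc.1.1, ?_⟩
        · rwa [List.flatten_cons, List.head?_append_of_ne_nil _ hm] at hh
        · rw [List.flatten_cons, ht]
          exact ⟨[], t ++ [a], by simp⟩
      · refine ⟨(ih x hx).1, (ih x hx).2.1, (ih x hx).2.2.trans ?_⟩
        rw [List.flatten_cons, ht']
        exact ⟨b :: t', [], by simp⟩

theorem not_isChain_of_infix {b a : A} {l : List A} (h : [b, a] <:+: l) :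
    ¬ l.IsChain (NoCut b a) := by
  intro hc
  have := hc.infix h
  simp [NoCut] at this

theorem infix_of_not_isChain {b a : A} {l : List A} (h : ¬ l.IsChain (NoCut b a)) :
    [b, a] <:+: l := by
  by_contra hc
  apply h
  rw [List.isChain_iff_forall_rel_of_append_cons_cons]
  rintro x y l₁ l₂ rfl ⟨rfl, rfl⟩
  exact hc ⟨l₁, l₂, by simp⟩

/-- The last cut is chosen so that what follows it has no cut. With the mirror statement for the
first cut, this keeps `blockDefect` bounded. -/
theorem exists_last_cut {b a : A} {l : List A} (h : [b, a] <:+: l) :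
    ∃ p q, l = p ++ q ∧ p.getLast? = some b ∧ q.head? = some a ∧ q.IsChain (NoCut b a) := by
  induction l with
  | nil => simp at h
  | cons x l ih =>
    by_cases h' : [b, a] <:+: l
    · obtain ⟨p, q, rfl, hp, hq, hc⟩ := ih h'
      refine ⟨x :: p, q, rfl, ?_, hq, hc⟩
      rw [List.getLast?_cons, hp]; rfl
    · have hc : l.IsChain (NoCut b a) := by
        by_contra hc; exact h' (infix_of_not_isChain hc)
      rcases List.infix_cons_iff.1 h with h | h
      · obtain ⟨t, ht⟩ := h
        simp only [List.cons_append, List.nil_append, List.cons.injEq] at ht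
        obtain ⟨rfl, rfl⟩ := ht
        exact ⟨[b], a :: t, rfl, rfl, rfl, hc⟩
      · exact absurd h h'

theorem exists_first_cut {b a : A} {l : List A} (h : [b, a] <:+: l) :
    ∃ p q, l = p ++ q ∧ p.getLast? = some b ∧ q.head? = some a ∧ p.IsChain (NoCut b a) := by
  induction l with
  | nil => simp at h
  | cons x l ih =>
    by_cases hx : x = b ∧ l.head? = some a
    · exact ⟨[x], l, rfl, by simp [hx.1], hx.2, by simp⟩
    · rcases List.infix_cons_iff.1 h with h | h
      · obtain ⟨t, ht⟩ := h
        simp only [List.cons_append, List.nil_append, List.cons.injEq] at ht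
        obtain ⟨rfl, rfl⟩ := ht
        simp at hx
      · obtain ⟨p, q, rfl, hp, hq, hc⟩ := ih h
        refine ⟨x :: p, q, rfl, by rw [List.getLast?_cons, hp]; rfl, hq, ?_⟩
        rcases p with _ | ⟨y, p⟩
        · simp
        · refine List.isChain_cons_cons.2 ⟨?_, hc⟩
          rintro ⟨rfl, rfl⟩
          simp at hx

variable [DecidableEq A]

instance (b a x y : A) : Decidable (NoCut b a x y) := by unfold NoCut; infer_instance

/-- The blocks of a word, obtained by cutting it in the middle of each occurrence of `ba`. -/
def blocks (b a : A) (l : List A) : List (List A) := l.splitBy fun x y => decide (NoCut b a x y)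

/-- Uniqueness of the block decomposition. It makes the return words a code. -/
theorem blocks_flatten {b a : A} {L : List (List A)} (hn : [] ∉ L)
    (hc : ∀ m ∈ L, m.IsChain (NoCut b a))
    (hL : L.IsChain fun u v => u.getLast? = some b ∧ v.head? = some a) :
    blocks b a L.flatten = L := by
  unfold blocks
  refine List.splitBy_flatten hn (fun m hm => by simpa using hc m hm) ?_
  refine hL.imp fun u v h => ?_
  have hu : u ≠ [] := by rintro rfl; simp at h
  have hv : v ≠ [] := by rintro rfl; simp at h
  refine ⟨hu, hv, ?_⟩
  have h1 := h.1
  have h2 := h.2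
  rw [List.getLast?_eq_some_getLast hu] at h1
  rw [List.head?_eq_some_head hv] at h2
  simp_all [NoCut]

theorem flatten_blocks (b a : A) (l : List A) : (blocks b a l).flatten = l :=
  List.flatten_splitBy _ _

theorem nil_notMem_blocks (b a : A) (l : List A) : [] ∉ blocks b a l :=
  List.nil_notMem_splitBy _ _

theorem blocks_ne_nil {b a : A} {l : List A} : blocks b a l ≠ [] ↔ l ≠ [] :=
  List.splitBy_ne_nil

theorem isChain_of_mem_blocks {b a : A} {l m : List A} (h : m ∈ blocks b a l) :
    m.IsChain (NoCut b a) := by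
  simpa using List.isChain_of_mem_splitBy h

theorem isChain_blocks (b a : A) (l : List A) :
    (blocks b a l).IsChain fun u v => u.getLast? = some b ∧ v.head? = some a := by
  refine (List.isChain_getLast_head_splitBy _ l).imp ?_
  rintro u v ⟨hu, hv, h⟩
  rw [List.getLast?_eq_some_getLast hu, List.head?_eq_some_head hv]
  simpa [NoCut] using h

theorem blocks_of_isChain {b a : A} {l : List A} (hl : l ≠ []) (h : l.IsChain (NoCut b a)) :
    blocks b a l = [l] :=
  List.splitBy_of_isChain hl (by simpa using h)

theorem blocks_append {b a : A} {u v : List A} (hu : u.getLast? = some b)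
    (hv : v.head? = some a) : blocks b a (u ++ v) = blocks b a u ++ blocks b a v := by
  conv_lhs => rw [← flatten_blocks b a u, ← flatten_blocks b a v, ← List.flatten_append]
  refine blocks_flatten ?_ ?_ ?_
  · simp [nil_notMem_blocks]
  · intro m hm
    rcases List.mem_append.1 hm with h | h <;> exact isChain_of_mem_blocks h
  · refine List.isChain_append.2 ⟨isChain_blocks _ _ _, isChain_blocks _ _ _, ?_⟩
    intro x hx y hy
    have hxe := List.ne_nil_of_mem (List.mem_of_mem_getLast? hx)
    have hue : u ≠ [] := by rintro rfl; simp at hu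
    have hve : v ≠ [] := by rintro rfl; simp at hv
    have e1 := List.getLast_getLast_splitBy (fun x y => decide (NoCut b a x y)) hue
    have e2 := List.head_head_splitBy (fun x y => decide (NoCut b a x y)) hve
    have hx' : (u.splitBy fun x y => decide (NoCut b a x y)).getLast
        (List.splitBy_ne_nil.2 hue) = x := by
      have := List.getLast?_eq_some_getLast (List.splitBy_ne_nil (r := fun x y => decide (NoCut b a x y)) |>.2 hue)
      unfold blocks at hx
      rw [this] at hx
      simpa using hx
    have hy' : (v.splitBy fun x y => decide (NoCut b a x y)).head
        (List.splitBy_ne_nil.2 hve) = y := by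
      have := List.head?_eq_some_head (List.splitBy_ne_nil (r := fun x y => decide (NoCut b a x y)) |>.2 hve)
      unfold blocks at hy
      rw [this] at hy
      simpa using hy
    subst hx' hy'
    rw [List.getLast?_eq_some_getLast (List.ne_nil_of_mem_splitBy (List.getLast_mem _)),
      List.head?_eq_some_head (List.ne_nil_of_mem_splitBy (List.head_mem _)), e1, e2,
      ← List.getLast?_eq_some_getLast, ← List.head?_eq_some_head]
    exact ⟨hu, hv⟩

theorem mem_blocks {b a : A} {l m : List A} (hh : l.head? = some a) (hl : l.getLast? = some b)
    (hm : m ∈ blocks b a l) : m.head? = some a ∧ m.getLast? = some b ∧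
      (b :: m ++ [a]) <:+: (b :: l ++ [a]) := by
  have := mem_chain_blocks (nil_notMem_blocks b a l) (isChain_blocks b a l)
    (by rwa [flatten_blocks]) (by rwa [flatten_blocks]) m hm
  rwa [flatten_blocks] at this

/-- How many more copies of `s` there are among the blocks of `q ++ p` than among those of `q` and
of `p`. -/
def blockDefect (b a : A) (s q p : List A) : ℤ :=
  (blocks b a (q ++ p)).count s - (blocks b a q).count s - (blocks b a p).count s

/-- Each of `q` and `p` is a single block, and `q ++ p` consists of one or two blocks according to
whether a cut appears at the junction. -/
theorem blockDefect_mem {b a : A} (s : List A) {q p : List A} (hq : q.IsChain (NoCut b a))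
    (hp : p.IsChain (NoCut b a)) (hq' : q ≠ []) (hp' : p ≠ []) :
    blockDefect b a s q p ∈ Set.Icc (-2 : ℤ) 2 := by
  have h1 : ((blocks b a q).count s : ℤ) ≤ 1 := by
    rw [blocks_of_isChain hq' hq]; exact_mod_cast List.count_le_length
  have h2 : ((blocks b a p).count s : ℤ) ≤ 1 := by
    rw [blocks_of_isChain hp' hp]; exact_mod_cast List.count_le_length
  have h3 : ((blocks b a (q ++ p)).count s : ℤ) ≤ 2 := by
    by_cases h : q.getLast? = some b ∧ p.head? = some a
    · rw [blocks_append h.1 h.2, blocks_of_isChain hq' hq, blocks_of_isChain hp' hp]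
      exact_mod_cast List.count_le_length
    · rw [blocks_of_isChain (by simp [hq'])]
      · exact_mod_cast List.count_le_length.trans (by simp)
      · refine List.isChain_append.2 ⟨hq, hp, ?_⟩
        rintro x hx y hy ⟨rfl, rfl⟩
        exact h ⟨hx, hy⟩
  simp only [Set.mem_Icc, blockDefect]
  omega

/-- Blocks are additive at a cut, so only `q ++ p'`, the stretch between the two marked cuts, can
contribute an error. -/
theorem count_blocks_append {b a : A} (s p q p' q' : List A) (hp : p.getLast? = some b)
    (hq : q.head? = some a) (hp' : p'.getLast? = some b) (hq' : q'.head? = some a) :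
    ((blocks b a ((p ++ q) ++ (p' ++ q'))).count s : ℤ) = (blocks b a (p ++ q)).count s +
      (blocks b a (p' ++ q')).count s + blockDefect b a s q p' := by
  have hqe : q ≠ [] := by rintro rfl; simp at hq
  have hpe : p' ≠ [] := by rintro rfl; simp at hp'
  have h : (p ++ q) ++ (p' ++ q') = p ++ ((q ++ p') ++ q') := by simp
  rw [h, blocks_append hp (by rwa [List.append_assoc, List.head?_append_of_ne_nil _ hqe]),
    blocks_append (by rwa [List.getLast?_append_of_ne_nil _ hpe]) hq', blocks_append hp hq,
    blocks_append hp' hq', blockDefect]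
  simp only [List.count_append]
  push_cast
  ring

end Blocks

/-! ### Morphisms, incidence matrices and powers that preserve a cut -/

section Morphisms

variable {A B C : Type*}

section Img

variable {F : Type*} [FunLike F (FreeMonoid A) (FreeMonoid B)]

/-- The image of a word under a morphism, as a list. -/
def img (f : F) (l : List A) : List B :=
  (f (FreeMonoid.ofList l)).toList

variable [MonoidHomClass F (FreeMonoid A) (FreeMonoid B)]

@[simp] theorem img_nil (f : F) : img f [] = [] := by
  simp [img]

@[simp] theorem img_append (f : F) (u v : List A) :
    img f (u ++ v) = img f u ++ img f v := by
  simp [img, FreeMonoid.ofList_append]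

theorem img_cons (f : F) (x : A) (v : List A) :
    img f (x :: v) = img f [x] ++ img f v := by
  rw [← img_append]; rfl

theorem img_infix (f : F) {u v : List A} (h : u <:+: v) :
    img f u <:+: img f v := by
  obtain ⟨s, t, rfl⟩ := h
  exact ⟨img f s, img f t, by simp⟩

theorem head?_img (f : F) {l : List A} {x : A} (h : l.head? = some x)
    (hx : img f [x] ≠ []) : (img f l).head? = (img f [x]).head? := by
  obtain ⟨t, rfl⟩ := List.head?_eq_some_iff.1 h
  rw [img_cons, List.head?_append_of_ne_nil _ hx]

theorem getLast?_img (f : F) {l : List A} {x : A}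
    (h : l.getLast? = some x) (hx : img f [x] ≠ []) :
    (img f l).getLast? = (img f [x]).getLast? := by
  obtain ⟨t, rfl⟩ := List.getLast?_eq_some_iff.1 h
  rw [img_append, List.getLast?_append_of_ne_nil _ hx]

end Img

theorem img_comp (g : FreeMonoid B →* FreeMonoid C) (f : FreeMonoid A →* FreeMonoid B)
    (l : List A) : img (g.comp f) l = img g (img f l) := rfl

theorem img_lift (f : A → List B) (l : List A) :
    img (FreeMonoid.lift fun x => FreeMonoid.ofList (f x)) l = l.flatMap f := by
  induction l with
  | nil => simp
  | cons x l ih => rw [img_cons, ih]; simp [img]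

theorem img_pow_add (σ : Monoid.End (FreeMonoid A)) (m n : ℕ) (l : List A) :
    img (σ ^ (m + n)) l = img (σ ^ m) (img (σ ^ n) l) := by
  unfold img; rw [pow_add]; rfl

theorem img_pow_zero (σ : Monoid.End (FreeMonoid A)) (l : List A) : img (σ ^ 0) l = l := rfl

theorem img_pow_one (σ : Monoid.End (FreeMonoid A)) (l : List A) : img (σ ^ 1) l = img σ l := by
  rw [pow_one]

theorem singleton_infix {x : A} {l : List A} (h : x ∈ l) : [x] <:+: l := by
  obtain ⟨s, t, rfl⟩ := List.append_of_mem h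
  exact ⟨s, t, by simp⟩

theorem mem_language {σ : Monoid.End (FreeMonoid A)} {w : List A} :
    w ∈ language σ ↔ ∃ (n : ℕ) (c : A), w <:+: img (σ ^ n) [c] := Iff.rfl

theorem language_infix {σ : Monoid.End (FreeMonoid A)} {u w : List A} (hw : w ∈ language σ)
    (h : u <:+: w) : u ∈ language σ := by
  obtain ⟨n, c, hc⟩ := hw
  exact ⟨n, c, h.trans hc⟩

theorem language_img {σ : Monoid.End (FreeMonoid A)} (n : ℕ) {w : List A} (hw : w ∈ language σ) :
    img (σ ^ n) w ∈ language σ := by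
  obtain ⟨m, c, hc⟩ := mem_language.1 hw
  refine mem_language.2 ⟨n + m, c, ?_⟩
  rw [img_pow_add]
  exact img_infix _ hc

/-- Every word of the language is a factor of all sufficiently large iterates. -/
def LanguagePrimitive (σ : Monoid.End (FreeMonoid A)) : Prop :=
  ∀ w ∈ language σ, ∃ N, ∀ n ≥ N, ∀ d, w <:+: img (σ ^ n) [d]

theorem LanguagePrimitive.language_pow {σ : Monoid.End (FreeMonoid A)} (h : LanguagePrimitive σ)
    {k : ℕ} (hk : 0 < k) : language (σ ^ k) = language σ := by
  ext w
  constructor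
  · rintro ⟨n, c, hc⟩
    exact ⟨k * n, c, by rwa [pow_mul]⟩
  · intro hw
    obtain ⟨N, hN⟩ := h w hw
    obtain ⟨-, c, -⟩ := hw
    refine ⟨N, c, ?_⟩
    rw [← pow_mul]
    exact hN (k * N) (Nat.le_mul_of_pos_left N hk) c

theorem LanguagePrimitive.pow {σ : Monoid.End (FreeMonoid A)} (h : LanguagePrimitive σ)
    {k : ℕ} (hk : 0 < k) : LanguagePrimitive (σ ^ k) := by
  intro w hw
  rw [h.language_pow hk] at hw
  obtain ⟨N, hN⟩ := h w hw
  refine ⟨N, fun n hn d => ?_⟩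
  rw [← pow_mul]
  exact hN _ (hn.trans (Nat.le_mul_of_pos_left n hk)) d

theorem substSubshift_pow [TopologicalSpace A] [DiscreteTopology A]
    {σ : Monoid.End (FreeMonoid A)} (h : LanguagePrimitive σ) {k : ℕ} (hk : 0 < k) :
    substSubshift (σ ^ k) = substSubshift σ := by
  simp only [substSubshift, h.language_pow hk]

theorem IsSubstitution.img_pow_ne_nil {σ : Monoid.End (FreeMonoid A)} (h : IsSubstitution σ)
    (n : ℕ) (c : A) : img (σ ^ n) [c] ≠ [] := by
  intro h0
  have h1 := (h.2 c).eventually_ge_atTop 1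
  obtain ⟨m, hm1, hm2⟩ := (h1.and (eventually_ge_atTop n)).exists
  have : img (σ ^ m) [c] = [] := by
    rw [← Nat.sub_add_cancel hm2, img_pow_add, h0, img_nil]
  have h3 : (img (σ ^ m) [c]).length = 0 := by rw [this]; rfl
  have h4 : (img (σ ^ m) [c]).length = ((σ ^ m) (FreeMonoid.of c)).length := rfl
  omega

section Incidence

section Apply

variable [DecidableEq B]

variable {F : Type*} [FunLike F (FreeMonoid A) (FreeMonoid B)]

/-- The incidence matrix of a morphism between free monoids. -/
def inc (f : F) : Matrix B A ℤ :=
  Matrix.of fun i j => ((img f [j]).count i : ℤ)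

theorem inc_apply (f : F) (i : B) (j : A) :
    inc f i j = ((img f [j]).count i : ℤ) := rfl

variable [MonoidHomClass F (FreeMonoid A) (FreeMonoid B)]

theorem count_img [Fintype A] [DecidableEq A] (f : F) (l : List A) (i : B) :
    ((img f l).count i : ℤ) = ∑ j, inc f i j * (l.count j : ℤ) := by
  induction l with
  | nil => simp
  | cons x l ih =>
    rw [img_cons, List.count_append]
    push_cast
    rw [ih]
    simp only [List.count_cons, Nat.cast_add, mul_add, Finset.sum_add_distrib]
    simp [inc_apply, add_comm]

end Apply

variable [DecidableEq A] [DecidableEq B] [DecidableEq C]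

omit [DecidableEq A] in
theorem inc_comp [Fintype B] (g : FreeMonoid B →* FreeMonoid C)
    (f : FreeMonoid A →* FreeMonoid B) : inc (g.comp f) = inc g * inc f := by
  ext i j
  rw [inc_apply, img_comp, count_img, Matrix.mul_apply]
  rfl

theorem incidenceMatrix_eq_inc (σ : Monoid.End (FreeMonoid A)) :
    incidenceMatrix σ = inc σ := rfl

theorem inc_mul [Fintype A] (σ τ : Monoid.End (FreeMonoid A)) :
    inc (σ * τ) = inc σ * inc τ := inc_comp _ _

theorem inc_pow [Fintype A] (σ : Monoid.End (FreeMonoid A)) (n : ℕ) :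
    inc (σ ^ n) = inc σ ^ n := by
  induction n with
  | zero =>
    ext i j
    rw [inc_apply, img_pow_zero, pow_zero, Matrix.one_apply]
    rcases eq_or_ne i j with rfl | h
    · simp
    · simp [h, h.symm]
  | succ n ih => rw [pow_succ, pow_succ, inc_mul, ih]

theorem incidenceMatrix_pow [Fintype A] (σ : Monoid.End (FreeMonoid A)) (n : ℕ) :
    incidenceMatrix (σ ^ n) = incidenceMatrix σ ^ n := inc_pow σ n

theorem IsPrimitiveSubstitution.languagePrimitive [Fintype A] {σ : Monoid.End (FreeMonoid A)}
    (h : IsPrimitiveSubstitution σ) : LanguagePrimitive σ := by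
  obtain ⟨k, -, hk⟩ := h.2.exists_pos_pow
  have key : ∀ n ≥ k, ∀ c d, c ∈ img (σ ^ n) [d] := by
    intro n hn c d
    obtain ⟨e, he⟩ := List.exists_mem_of_ne_nil _ (h.1.img_pow_ne_nil (n - k) d)
    have h1 := hk c e
    rw [← incidenceMatrix_pow, incidenceMatrix_eq_inc, inc_apply] at h1
    have h2 : c ∈ img (σ ^ k) [e] := List.count_pos_iff.1 (by exact_mod_cast h1)
    have h3 := img_infix (σ ^ k) (singleton_infix he)
    rw [← img_pow_add, Nat.add_sub_cancel' hn] at h3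
    exact h3.subset h2
  rintro w ⟨m, c, hc⟩
  refine ⟨m + k, fun n hn d => hc.trans ?_⟩
  have h3 := img_infix (σ ^ m) (singleton_infix (key (n - m) (by omega) c d))
  rwa [← img_pow_add, Nat.add_sub_cancel' (by omega)] at h3

end Incidence

/-- Some power of a substitution fixes the two letters around a cut of its language. -/
theorem exists_periodic_pair [Finite A] {σ : Monoid.End (FreeMonoid A)} (h : IsSubstitution σ) :
    ∃ a b : A, ∃ k > 0, [b, a] ∈ language σ ∧ (img (σ ^ k) [a]).head? = some a ∧
      (img (σ ^ k) [b]).getLast? = some b := by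
  have h2 : ∃ c d, [c, d] ∈ language σ := by
    obtain ⟨e, -⟩ := h.1
    obtain ⟨n, hn⟩ := ((h.2 e).eventually_ge_atTop 2).exists
    have h3 : 2 ≤ (img (σ ^ n) [e]).length := hn
    rcases hl : img (σ ^ n) [e] with _ | ⟨c, _ | ⟨d, l⟩⟩
    · simp [hl] at h3
    · simp [hl] at h3
    · exact ⟨c, d, n, e, by change _ <:+: img (σ ^ n) [e]; rw [hl]; exact ⟨[], l, by simp⟩⟩
  obtain ⟨c, d, hcd⟩ := h2
  -- Pigeonhole on the pair of letters around the junction of `σⁿ(c)` and `σⁿ(d)`: the pair reached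
  -- at time `i` recurs at time `j`, so `σ^(j - i)` fixes it.
  obtain ⟨i, j, hij, hG⟩ : ∃ i j : ℕ, i < j ∧
      ((img (σ ^ i) [c]).getLast?, (img (σ ^ i) [d]).head?) =
      ((img (σ ^ j) [c]).getLast?, (img (σ ^ j) [d]).head?) := by
    obtain ⟨i, j, hne, he⟩ := Finite.exists_ne_map_eq_of_infinite
      fun n : ℕ => ((img (σ ^ n) [c]).getLast?, (img (σ ^ n) [d]).head?)
    rcases lt_or_gt_of_ne hne with h | h
    · exact ⟨i, j, h, he⟩
    · exact ⟨j, i, h, he.symm⟩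
  obtain ⟨b, hb⟩ : ∃ b, (img (σ ^ i) [c]).getLast? = some b :=
    ⟨_, List.getLast?_eq_some_getLast (h.img_pow_ne_nil i c)⟩
  obtain ⟨a, ha⟩ : ∃ a, (img (σ ^ i) [d]).head? = some a :=
    ⟨_, List.head?_eq_some_head (h.img_pow_ne_nil i d)⟩
  rw [Prod.mk.injEq, hb, ha] at hG
  refine ⟨a, b, j - i, by omega, ?_, ?_, ?_⟩
  · refine language_infix (language_img i hcd) ?_
    rw [img_cons]
    obtain ⟨t, ht⟩ := List.head?_eq_some_iff.1 ha
    obtain ⟨t', ht'⟩ := List.getLast?_eq_some_iff.1 hb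
    exact ⟨t', t, by rw [ht, ht']; simp⟩
  · rw [← head?_img _ ha (h.img_pow_ne_nil _ _), ← img_pow_add, Nat.sub_add_cancel hij.le, ← hG.2]
  · rw [← getLast?_img _ hb (h.img_pow_ne_nil _ _), ← img_pow_add, Nat.sub_add_cancel hij.le,
      ← hG.1]

/-- A morphism that preserves the cut between `b` and `a` and creates one in each letter. -/
structure CutsAt (σ : Monoid.End (FreeMonoid A)) (b a : A) : Prop where
  infix_img : ∀ c, [b, a] <:+: img σ [c]
  head_img : (img σ [a]).head? = some a
  last_img : (img σ [b]).getLast? = some b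

theorem CutsAt.img_ne_nil {σ : Monoid.End (FreeMonoid A)} {b a : A} (h : CutsAt σ b a) (c : A) :
    img σ [c] ≠ [] := by
  intro h0
  have := h.infix_img c
  rw [h0] at this
  simp at this

theorem CutsAt.mem_language {σ : Monoid.End (FreeMonoid A)} {b a : A} (h : CutsAt σ b a) :
    [b, a] ∈ language σ :=
  ⟨1, a, by rw [pow_one]; exact h.infix_img a⟩

theorem exists_cutsAt [Fintype A] [DecidableEq A] {σ : Monoid.End (FreeMonoid A)}
    (h : IsPrimitiveSubstitution σ) : ∃ k > 0, ∃ a b, CutsAt (σ ^ k) b a := by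
  obtain ⟨a, b, k, hk, hL, ha, hb⟩ := exists_periodic_pair h.1
  obtain ⟨N, hN⟩ := h.languagePrimitive _ hL
  have hpow : ∀ n, (img (σ ^ (k * n)) [a]).head? = some a ∧
      (img (σ ^ (k * n)) [b]).getLast? = some b := by
    intro n
    induction n with
    | zero => exact ⟨rfl, rfl⟩
    | succ n ih =>
      rw [Nat.mul_succ, img_pow_add, img_pow_add]
      exact ⟨by rw [head?_img _ ha (h.1.img_pow_ne_nil _ _), ih.1],
        by rw [getLast?_img _ hb (h.1.img_pow_ne_nil _ _), ih.2]⟩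
  -- A multiple of `k` keeps the two letters fixed, and an exponent at least `N` puts `ba` into the
  -- image of every letter.
  refine ⟨k * (N + 1), by positivity, a, b, ?_, (hpow _).1, (hpow _).2⟩
  exact fun c => hN _ (by nlinarith) c

theorem CutsAt.pow {σ : Monoid.End (FreeMonoid A)} {b a : A} (h : CutsAt σ b a) {n : ℕ}
    (hn : 0 < n) : CutsAt (σ ^ n) b a := by
  induction n, hn using Nat.le_induction with
  | base => simpa using h
  | succ n hn ih =>
    refine ⟨fun c => ?_, ?_, ?_⟩
    · rw [img_pow_add, img_pow_one]
      obtain ⟨d, hd⟩ := List.exists_mem_of_ne_nil _ (h.img_ne_nil c)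
      exact (ih.infix_img d).trans (img_infix _ (singleton_infix hd))
    · rw [img_pow_add, img_pow_one, head?_img _ h.head_img (ih.img_ne_nil _), ih.head_img]
    · rw [img_pow_add, img_pow_one, getLast?_img _ h.last_img (ih.img_ne_nil _), ih.last_img]

end Morphisms

/-! ### Return words and the substitution induced on them -/

section ReturnWords

variable {A : Type*}

/-- A return word: a factor between two consecutive occurrences of the cut between `b` and `a`. -/
structure IsReturnWord (σ : Monoid.End (FreeMonoid A)) (b a : A) (r : List A) : Prop where
  head : r.head? = some a
  last : r.getLast? = some b
  chain : r.IsChain (NoCut b a)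
  mem : b :: r ++ [a] ∈ language σ

abbrev ReturnWord (σ : Monoid.End (FreeMonoid A)) (b a : A) := {r // IsReturnWord σ b a r}

theorem IsReturnWord.ne_nil {σ : Monoid.End (FreeMonoid A)} {b a : A} {r : List A}
    (h : IsReturnWord σ b a r) : r ≠ [] := by
  rintro rfl
  simpa using h.head

/-- The morphism that spells return words out. -/
def spell (σ : Monoid.End (FreeMonoid A)) (b a : A) :
    FreeMonoid (ReturnWord σ b a) →* FreeMonoid A :=
  FreeMonoid.lift fun r => FreeMonoid.ofList r.1

theorem img_spell (σ : Monoid.End (FreeMonoid A)) (b a : A) (t : List (ReturnWord σ b a)) :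
    img (spell σ b a) t = (t.map Subtype.val).flatten := by
  rw [spell, img_lift, List.flatMap_def]

theorem img_spell_singleton (σ : Monoid.End (FreeMonoid A)) (b a : A) (r : ReturnWord σ b a) :
    img (spell σ b a) [r] = r.1 := by
  simp [img_spell]

variable {σ : Monoid.End (FreeMonoid A)} {b a : A}

theorem length_le_of_prefix (h : CutsAt σ b a) {M : ℕ} (hM : ∀ c, (img σ [c]).length ≤ M)
    {w l : List A} (hw : w.IsChain (NoCut b a)) (hp : w <+: img σ l) : w.length ≤ M := by
  rcases l with _ | ⟨c, l⟩
  · simp at hp; simp [hp]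
  · rw [img_cons] at hp
    rcases List.prefix_or_prefix_of_prefix hp (List.prefix_append _ _) with h1 | h1
    · exact h1.length_le.trans (hM c)
    · exact absurd (hw.infix h1.isInfix) (not_isChain_of_infix (h.infix_img c))

/-- Every image of a letter contains a cut, so a word without cuts contains no complete image and
meets at most two consecutive ones. -/
theorem length_le_of_infix (h : CutsAt σ b a) {M : ℕ} (hM : ∀ c, (img σ [c]).length ≤ M)
    {w l : List A} (hw : w.IsChain (NoCut b a)) (hp : w <:+: img σ l) : w.length ≤ M + M := by
  induction l with
  | nil => simp at hp; simp [hp]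
  | cons c l ih =>
    rw [img_cons, List.infix_append_iff] at hp
    rcases hp with hp | hp | ⟨u, v, rfl, hu, hv⟩
    · exact hp.length_le.trans ((hM c).trans (by omega))
    · exact ih hp
    · have h1 := hu.length_le.trans (hM c)
      have h2 := length_le_of_prefix h hM (List.isChain_append.1 hw).2.1 hv
      rw [List.length_append]
      omega

/-- A return word occurs in some `σ(σ^N(a))` and has no cut, so its length is at most twice that of
the longest image of a letter. -/
theorem finite_returnWord [Finite A] (hL : LanguagePrimitive σ) (h : CutsAt σ b a) :
    Finite (ReturnWord σ b a) := by
  cases nonempty_fintype A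
  obtain ⟨M, hM⟩ : ∃ M, ∀ c, (img σ [c]).length ≤ M :=
    ⟨Finset.univ.sup fun c => (img σ [c]).length, fun c =>
      Finset.le_sup (f := fun c => (img σ [c]).length) (Finset.mem_univ c)⟩
  refine ((List.finite_length_le A (M + M)).subset ?_).to_subtype
  intro r hr
  obtain ⟨N, hN⟩ := hL _ hr.mem
  have h1 := hN (1 + N) (by omega) a
  rw [img_pow_add, img_pow_one] at h1
  exact length_le_of_infix h hM hr.chain (List.IsInfix.trans ⟨[b], [a], by simp⟩ h1)

theorem exists_returnWord_list [DecidableEq A] {l : List A} (hh : l.head? = some a)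
    (hl : l.getLast? = some b) (hm : b :: l ++ [a] ∈ language σ) :
    ∃ t, img (spell σ b a) t = l := by
  have key : ∀ m ∈ blocks b a l, IsReturnWord σ b a m := fun m hmem =>
    have := mem_blocks hh hl hmem
    ⟨this.1, this.2.1, isChain_of_mem_blocks hmem, language_infix hm this.2.2⟩
  refine ⟨(blocks b a l).attachWith _ key, ?_⟩
  rw [img_spell, List.attachWith_map_subtype_val, flatten_blocks]

theorem blocks_img_spell [DecidableEq A] (t : List (ReturnWord σ b a)) :
    blocks b a (img (spell σ b a) t) = t.map Subtype.val := by
  rw [img_spell]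
  refine blocks_flatten ?_ ?_ ?_
  · rintro h
    obtain ⟨r, -, hr⟩ := List.mem_map.1 h
    exact r.2.ne_nil hr
  · intro m hm
    obtain ⟨r, -, rfl⟩ := List.mem_map.1 hm
    exact r.2.chain
  · induction t with
    | nil => simp
    | cons r t ih =>
      rw [List.map_cons, List.isChain_cons]
      refine ⟨fun y hy => ⟨r.2.last, ?_⟩, ih⟩
      obtain ⟨s, -, rfl⟩ := List.mem_map.1 (List.mem_of_mem_head? hy)
      exact s.2.head

theorem head?_img_of_isReturnWord (h : CutsAt σ b a) {r : List A} (hr : IsReturnWord σ b a r) :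
    (img σ r).head? = some a := by
  rw [head?_img _ hr.head (h.img_ne_nil _), h.head_img]

theorem getLast?_img_of_isReturnWord (h : CutsAt σ b a) {r : List A}
    (hr : IsReturnWord σ b a r) : (img σ r).getLast? = some b := by
  rw [getLast?_img _ hr.last (h.img_ne_nil _), h.last_img]

theorem mem_language_img_of_isReturnWord (h : CutsAt σ b a) {r : List A}
    (hr : IsReturnWord σ b a r) : b :: img σ r ++ [a] ∈ language σ := by
  have h1 := language_img 1 hr.mem
  rw [img_pow_one, img_append, img_cons] at h1
  refine language_infix h1 ?_
  obtain ⟨t, ht⟩ := List.head?_eq_some_iff.1 h.head_img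
  obtain ⟨t', ht'⟩ := List.getLast?_eq_some_iff.1 h.last_img
  rw [ht, ht']
  exact ⟨t', t, by simp⟩

/-- The substitution induced on return words. -/
theorem exists_returnSubst (h : CutsAt σ b a) : ∃ τ : Monoid.End (FreeMonoid (ReturnWord σ b a)),
    ∀ l, img (spell σ b a) (img τ l) = img σ (img (spell σ b a) l) := by
  classical
  have : ∀ r : ReturnWord σ b a, ∃ t, img (spell σ b a) t = img σ r.1 := fun r =>
    exists_returnWord_list (head?_img_of_isReturnWord h r.2) (getLast?_img_of_isReturnWord h r.2)
      (mem_language_img_of_isReturnWord h r.2)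
  choose f hf using this
  refine ⟨FreeMonoid.lift fun r => FreeMonoid.ofList (f r), fun l => ?_⟩
  erw [img_lift f l]
  induction l with
  | nil => simp
  | cons r l ih =>
    rw [img_cons _ r l, img_append, ← ih, List.flatMap_cons, img_append, hf, img_spell_singleton]

theorem exists_returnWord (h : CutsAt σ b a) : Nonempty (ReturnWord σ b a) := by
  classical
  have h1 := language_img 1 h.mem_language
  rw [img_pow_one, img_cons] at h1
  obtain ⟨p, q, e, hp, hq, -⟩ := exists_last_cut (h.infix_img b)
  obtain ⟨p', q', e', hp', hq', -⟩ := exists_last_cut (h.infix_img a)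
  have hqe : q ≠ [] := by rintro rfl; simp at hq
  have hpe : p' ≠ [] := by rintro rfl; simp at hp'
  -- The word `σ(b)σ(a)` is in the language, and `q ++ p'` is its part between a cut inside `σ(b)`
  -- and one inside `σ(a)`.
  obtain ⟨t, ht⟩ := exists_returnWord_list (σ := σ) (b := b) (a := a) (l := q ++ p')
    (by rwa [List.head?_append_of_ne_nil _ hqe]) (by rwa [List.getLast?_append_of_ne_nil _ hpe]) (by
      refine language_infix h1 ?_
      rw [e, e']
      obtain ⟨u, rfl⟩ := List.getLast?_eq_some_iff.1 hp
      obtain ⟨u', rfl⟩ := List.head?_eq_some_iff.1 hq'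
      exact ⟨u, u', by simp⟩)
  rcases t with _ | ⟨r, t⟩
  · simp [hqe] at ht
  · exact ⟨r⟩

variable {τ : Monoid.End (FreeMonoid (ReturnWord σ b a))}

theorem img_spell_pow (hτ : ∀ l, img (spell σ b a) (img τ l) = img σ (img (spell σ b a) l))
    (n : ℕ) (l : List (ReturnWord σ b a)) :
    img (spell σ b a) (img (τ ^ n) l) = img (σ ^ n) (img (spell σ b a) l) := by
  induction n generalizing l with
  | zero => rfl
  | succ n ih => rw [img_pow_add, img_pow_add, ih, img_pow_one, img_pow_one, hτ]

variable [DecidableEq A]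

theorem map_val_img_pow
    (hτ : ∀ l, img (spell σ b a) (img τ l) = img σ (img (spell σ b a) l)) (n : ℕ)
    (r : ReturnWord σ b a) :
    (img (τ ^ n) [r]).map Subtype.val = blocks b a (img (σ ^ n) r.1) := by
  rw [← blocks_img_spell, img_spell_pow hτ, img_spell_singleton]

theorem inc_returnSubst_pow
    (hτ : ∀ l, img (spell σ b a) (img τ l) = img σ (img (spell σ b a) l)) (n : ℕ)
    (s r : ReturnWord σ b a) :
    inc (τ ^ n) s r = ((blocks b a (img (σ ^ n) r.1)).count s.1 : ℤ) := by
  rw [inc_apply, ← map_val_img_pow hτ, List.count_map_of_injective _ _ Subtype.val_injective]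
  congr!

theorem map_val_img (hτ : ∀ l, img (spell σ b a) (img τ l) = img σ (img (spell σ b a) l))
    (r : ReturnWord σ b a) : (img τ [r]).map Subtype.val = blocks b a (img σ r.1) := by
  rw [← blocks_img_spell, hτ, img_spell_singleton]

/-- Every return word begins with `a`, and `σ(a)` has a cut. The blocks of `σ(a)` before that cut
therefore begin every `τ(r)`. -/
theorem returnSubst_head (h : CutsAt σ b a)
    (hτ : ∀ l, img (spell σ b a) (img τ l) = img σ (img (spell σ b a) l)) :
    ∃ f, ∀ r, (img τ [r]).head? = some f := by
  obtain ⟨p, q, e, hp, hq, -⟩ := exists_last_cut (h.infix_img a)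
  have hpe : p ≠ [] := by rintro rfl; simp at hp
  have hqe : q ≠ [] := by rintro rfl; simp at hq
  have key : ∀ r : ReturnWord σ b a,
      ((img τ [r]).head?).map Subtype.val = (blocks b a p).head? := by
    intro r
    rw [← List.head?_map, map_val_img hτ]
    obtain ⟨t, ht⟩ := List.head?_eq_some_iff.1 r.2.head
    rw [ht, img_cons, e, List.append_assoc, blocks_append hp
      (by rwa [List.head?_append_of_ne_nil _ hqe]),
      List.head?_append_of_ne_nil _ (blocks_ne_nil.2 hpe)]
  obtain ⟨x, hx⟩ : ∃ x, (blocks b a p).head? = some x :=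
    ⟨_, List.head?_eq_some_head (blocks_ne_nil.2 hpe)⟩
  obtain ⟨r₀⟩ := exists_returnWord h
  have h0 := key r₀
  rw [hx, Option.map_eq_some_iff] at h0
  obtain ⟨f, hf, rfl⟩ := h0
  refine ⟨f, fun r => ?_⟩
  have h1 := key r
  rw [hx, Option.map_eq_some_iff] at h1
  obtain ⟨g, hg, hgf⟩ := h1
  rw [hg, Subtype.ext hgf]

theorem returnSubst_last (h : CutsAt σ b a)
    (hτ : ∀ l, img (spell σ b a) (img τ l) = img σ (img (spell σ b a) l)) :
    ∃ f, ∀ r, (img τ [r]).getLast? = some f := by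
  obtain ⟨p, q, e, hp, hq, -⟩ := exists_last_cut (h.infix_img b)
  have hpe : p ≠ [] := by rintro rfl; simp at hp
  have hqe : q ≠ [] := by rintro rfl; simp at hq
  have key : ∀ r : ReturnWord σ b a,
      ((img τ [r]).getLast?).map Subtype.val = (blocks b a q).getLast? := by
    intro r
    rw [← List.getLast?_map, map_val_img hτ]
    obtain ⟨t, ht⟩ := List.getLast?_eq_some_iff.1 r.2.last
    rw [ht, img_append, e, ← List.append_assoc, blocks_append
      (by rwa [List.getLast?_append_of_ne_nil _ hpe]) hq,
      List.getLast?_append_of_ne_nil _ (blocks_ne_nil.2 hqe)]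
  obtain ⟨x, hx⟩ : ∃ x, (blocks b a q).getLast? = some x :=
    ⟨_, List.getLast?_eq_some_getLast (blocks_ne_nil.2 hqe)⟩
  obtain ⟨r₀⟩ := exists_returnWord h
  have h0 := key r₀
  rw [hx, Option.map_eq_some_iff] at h0
  obtain ⟨f, hf, rfl⟩ := h0
  refine ⟨f, fun r => ?_⟩
  have h1 := key r
  rw [hx, Option.map_eq_some_iff] at h1
  obtain ⟨g, hg, hgf⟩ := h1
  rw [hg, Subtype.ext hgf]

/-- Each letter of `l` contributes a cut inside its own image. The prefix `q` carries, in the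
induction, what is left after the cut in the preceding image. -/
theorem length_lt_length_blocks (h : CutsAt σ b a) (q l : List A) (hne : q ≠ [] ∨ l ≠ []) :
    l.length < (blocks b a (q ++ img σ l)).length := by
  induction l generalizing q with
  | nil =>
    simp only [ne_eq, not_true_eq_false, or_false] at hne
    simpa [List.length_pos_iff] using blocks_ne_nil.2 hne
  | cons c l ih =>
    obtain ⟨p, q', e, hp, hq, -⟩ := exists_last_cut (h.infix_img c)
    have hpe : p ≠ [] := by rintro rfl; simp at hp
    have hqe : q' ≠ [] := by rintro rfl; simp at hq
    have e2 : q ++ img σ (c :: l) = (q ++ p) ++ (q' ++ img σ l) := by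
      rw [img_cons, e]; simp
    rw [e2, blocks_append (by rwa [List.getLast?_append_of_ne_nil _ hpe])
      (by rwa [List.head?_append_of_ne_nil _ hqe]), List.length_append, List.length_cons]
    have h1 : 0 < (blocks b a (q ++ p)).length :=
      List.length_pos_iff.2 (blocks_ne_nil.2 (by simp [hpe]))
    have := ih q' (Or.inl hqe)
    omega

theorem length_lt_length_img_returnSubst (h : CutsAt σ b a)
    (hτ : ∀ l, img (spell σ b a) (img τ l) = img σ (img (spell σ b a) l))
    (r : ReturnWord σ b a) : r.1.length < (img τ [r]).length := by
  have h1 := congrArg List.length (map_val_img hτ r)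
  rw [List.length_map] at h1
  rw [h1]
  exact length_lt_length_blocks h [] r.1 (Or.inr r.2.ne_nil)

theorem mem_blocks_of_infix {l s : List A} (hs : s ≠ []) (hc : s.IsChain (NoCut b a))
    (hh : s.head? = some a) (hl : s.getLast? = some b) (h : b :: s ++ [a] <:+: l) :
    s ∈ blocks b a l := by
  obtain ⟨u, v, rfl⟩ := h
  have e : u ++ (b :: s ++ [a]) ++ v = (u ++ [b]) ++ (s ++ (a :: v)) := by simp
  rw [e, blocks_append (by simp) (by rwa [List.head?_append_of_ne_nil _ hs]),
    blocks_append hl rfl, blocks_of_isChain hs hc]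
  simp

theorem returnSubst_primitive [Finite A] (hL : LanguagePrimitive σ) (h : CutsAt σ b a)
    (hτ : ∀ l, img (spell σ b a) (img τ l) = img σ (img (spell σ b a) l)) :
    ∃ N, ∀ n ≥ N, ∀ r s, s ∈ img (τ ^ n) [r] := by
  have := finite_returnWord hL h
  cases nonempty_fintype (ReturnWord σ b a)
  choose N hN using fun s : ReturnWord σ b a => hL _ s.2.mem
  refine ⟨Finset.univ.sup N, fun n hn r s => ?_⟩
  have h1 := hN s n ((Finset.le_sup (Finset.mem_univ s)).trans hn) a
  have h2 : b :: s.1 ++ [a] <:+: img (σ ^ n) r.1 :=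
    h1.trans (img_infix _ (singleton_infix (List.mem_of_mem_head? r.2.head)))
  have h3 := mem_blocks_of_infix s.2.ne_nil s.2.chain s.2.head s.2.last h2
  rw [← map_val_img_pow hτ] at h3
  obtain ⟨s', hs', e⟩ := List.mem_map.1 h3
  rwa [← Subtype.ext e]

end ReturnWords

/-! ### The substitution on positions in return words -/

section Tower

theorem exists_pieces {X : Type*} (k : ℕ) (t : List X) (hk : 0 < k) (ht : k ≤ t.length) :
    ∃ f : Fin k → List X, (∀ p, f p ≠ []) ∧ (List.ofFn f).flatten = t := by
  induction k, hk using Nat.le_induction generalizing t with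
  | base => exact ⟨fun _ => t, fun _ => by rintro rfl; simp at ht, by simp⟩
  | succ k hk ih =>
    rcases t with _ | ⟨x, t⟩
    · simp at ht
    · obtain ⟨f, hf, hft⟩ := ih t (by simpa using ht)
      refine ⟨Fin.cons [x] f, fun p => ?_, ?_⟩
      · refine Fin.cases ?_ (fun p => ?_) p <;> simp [hf]
      · simp [List.ofFn_succ, hft]

variable {A : Type*}

/-- The data of a substitution on the levels of the towers over return words: the letters of `B`
are the positions in return words, and `q` cuts the second iterate of the substitution induced on
return words along these positions. -/
structure ReturnTower (σ : Monoid.End (FreeMonoid A)) (b a : A) (B : Type*) where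
  τ : Monoid.End (FreeMonoid (ReturnWord σ b a))
  spell_τ : ∀ l, img (spell σ b a) (img τ l) = img σ (img (spell σ b a) l)
  e : B ≃ Σ r : ReturnWord σ b a, Fin r.1.length
  q : B → List (ReturnWord σ b a)
  q_eq : ∀ x, ∃ l, l ≠ [] ∧ q x = img τ l
  flatten_q : ∀ r, (List.ofFn fun p => q (e.symm ⟨r, p⟩)).flatten = img τ (img τ [r])

variable {σ : Monoid.End (FreeMonoid A)} {b a : A} {B : Type*}

/-- Since `τ(r)` has more letters than `r` has positions, it splits into one nonempty piece per
position. The second application of `τ` then gives all pieces the same first letter and the same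
last letter, whence properness. -/
theorem exists_returnTower [DecidableEq A] (h : CutsAt σ b a)
    (e : B ≃ Σ r : ReturnWord σ b a, Fin r.1.length) : Nonempty (ReturnTower σ b a B) := by
  obtain ⟨τ, hτ⟩ := exists_returnSubst h
  have : ∀ r : ReturnWord σ b a, ∃ f : Fin r.1.length → List (ReturnWord σ b a),
      (∀ p, f p ≠ []) ∧ (List.ofFn f).flatten = img τ [r] := fun r =>
    exists_pieces _ _ (List.length_pos_iff.2 r.2.ne_nil)
      (length_lt_length_img_returnSubst h hτ r).le
  choose f hf hff using this
  refine ⟨⟨τ, hτ, e, fun x => img τ (f (e x).1 (e x).2), fun x => ⟨_, hf _ _, rfl⟩, fun r => ?_⟩⟩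
  rw [← hff]
  have hp : (fun p => img τ (f (e (e.symm ⟨r, p⟩)).1 (e (e.symm ⟨r, p⟩)).2)) =
      fun p => img τ (f r p) := by
    funext p
    rw [Equiv.apply_symm_apply]
  rw [hp]
  have key : ∀ L : List (List (ReturnWord σ b a)),
      (L.map (img τ)).flatten = img τ L.flatten := by
    intro L
    induction L with
    | nil => simp
    | cons x L ih => simp [ih]
  rw [← key, List.map_ofFn]
  rfl

namespace ReturnTower

/-- The word of all positions in a return word. -/
def levels (T : ReturnTower σ b a B) : FreeMonoid (ReturnWord σ b a) →* FreeMonoid B :=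
  FreeMonoid.lift fun r => FreeMonoid.ofList (List.ofFn fun p => T.e.symm ⟨r, p⟩)

/-- The morphism that groups the images of the positions into return words. -/
def group (T : ReturnTower σ b a B) : FreeMonoid B →* FreeMonoid (ReturnWord σ b a) :=
  FreeMonoid.lift fun x => FreeMonoid.ofList (T.q x)

/-- The substitution on the positions in return words. -/
def subst (T : ReturnTower σ b a B) : Monoid.End (FreeMonoid B) := T.levels.comp T.group

/-- The letter at a given position in a return word. -/
def letter (T : ReturnTower σ b a B) (x : B) : A := (T.e x).1.1.get (T.e x).2

variable (T : ReturnTower σ b a B)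

theorem img_levels_singleton (r : ReturnWord σ b a) :
    img T.levels [r] = List.ofFn fun p => T.e.symm ⟨r, p⟩ := by
  rw [levels, img_lift]; simp

theorem img_group_singleton (x : B) : img T.group [x] = T.q x := by
  rw [group, img_lift]; simp

theorem img_subst (l : List B) : img T.subst l = img T.levels (img T.group l) := rfl

theorem img_levels_ne_nil (r : ReturnWord σ b a) : img T.levels [r] ≠ [] := by
  rw [img_levels_singleton, ne_eq, List.ofFn_eq_nil_iff, List.length_eq_zero_iff]
  exact r.2.ne_nil

/-- This is `group ∘ levels = τ²`, the counterpart of `subst = levels ∘ group`. It transfers both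
dynamics and nonzero eigenvalues between the two alphabets. -/
theorem img_group_levels (l : List (ReturnWord σ b a)) :
    img T.group (img T.levels l) = img T.τ (img T.τ l) := by
  induction l with
  | nil => simp
  | cons r l ih =>
    rw [img_cons T.levels, img_append, ih, img_cons T.τ r, img_append, ← T.flatten_q,
      img_levels_singleton, group, img_lift, List.flatMap_def, List.map_ofFn]
    rfl

theorem img_subst_pow_levels (n : ℕ) (l : List (ReturnWord σ b a)) :
    img (T.subst ^ n) (img T.levels l) = img T.levels (img (T.τ ^ (2 * n)) l) := by
  induction n generalizing l with
  | zero => rfl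
  | succ n ih =>
    rw [img_pow_add, img_pow_one, img_subst, img_group_levels, ih, Nat.mul_succ, img_pow_add,
      img_pow_add T.τ 1 1, img_pow_one, img_pow_one]

theorem map_letter_levels (l : List (ReturnWord σ b a)) :
    (img T.levels l).map T.letter = img (spell σ b a) l := by
  induction l with
  | nil => simp
  | cons r l ih =>
    rw [img_cons T.levels, img_cons (spell σ b a), List.map_append, ih, img_levels_singleton,
      img_spell_singleton, List.map_ofFn]
    congr 1
    have : T.letter ∘ (fun p => T.e.symm ⟨r, p⟩) = r.1.get := by
      funext p
      exact congrArg (fun y : Σ r : ReturnWord σ b a, Fin r.1.length => y.1.1.get y.2)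
        (T.e.apply_symm_apply ⟨r, p⟩)
    rw [this, List.ofFn_get]

theorem mem_img_levels (x : B) : x ∈ img T.levels [(T.e x).1] := by
  rw [img_levels_singleton, List.mem_ofFn]
  exact ⟨(T.e x).2, by simp⟩

theorem exists_infix_img_subst (h : CutsAt σ b a) [DecidableEq A] (x : B) :
    ∃ r, img T.levels [r] <:+: img T.subst [x] := by
  obtain ⟨l, hl, e⟩ := T.q_eq x
  obtain ⟨s, hs⟩ := List.exists_mem_of_ne_nil _ hl
  obtain ⟨r, hr⟩ := List.exists_mem_of_length_pos
    (Nat.zero_lt_of_lt (length_lt_length_img_returnSubst h T.spell_τ s))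
  refine ⟨r, ?_⟩
  rw [img_subst, img_group_singleton, e]
  exact img_infix _ ((singleton_infix hr).trans (img_infix _ (singleton_infix hs)))

theorem length_le_length_img {X Y F : Type*} [FunLike F (FreeMonoid X) (FreeMonoid Y)]
    [MonoidHomClass F (FreeMonoid X) (FreeMonoid Y)] (f : F) (k : ℕ)
    (h : ∀ x, k ≤ (img f [x]).length) (l : List X) : k * l.length ≤ (img f l).length := by
  induction l with
  | nil => simp
  | cons x l ih =>
    rw [img_cons, List.length_append, List.length_cons, Nat.mul_succ]
    have := h x
    omega

theorem two_le_length_img_subst (h : CutsAt σ b a) [DecidableEq A] (x : B) :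
    2 ≤ (img T.subst [x]).length := by
  obtain ⟨l, hl, e⟩ := T.q_eq x
  have h1 : 2 * l.length ≤ (img T.τ l).length := by
    refine length_le_length_img _ _ (fun r => ?_) _
    have h1 := length_lt_length_img_returnSubst h T.spell_τ r
    have h2 := List.length_pos_iff.2 r.2.ne_nil
    omega
  have h2 : 1 * (img T.τ l).length ≤ (img T.levels (img T.τ l)).length :=
    length_le_length_img _ _ (fun r => List.length_pos_iff.2 (T.img_levels_ne_nil r)) _
  have h3 := List.length_pos_iff.2 hl
  rw [img_subst, img_group_singleton, e]
  omega

theorem two_pow_le_length (h : CutsAt σ b a) [DecidableEq A] (n : ℕ) (x : B) :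
    2 ^ n ≤ (img (T.subst ^ n) [x]).length := by
  induction n with
  | zero => exact le_rfl
  | succ n ih =>
    rw [add_comm, img_pow_add, img_pow_one, pow_add, pow_one]
    exact (Nat.mul_le_mul_left 2 ih).trans
      (length_le_length_img _ _ (T.two_le_length_img_subst h) _)

theorem subst_head (h : CutsAt σ b a) [DecidableEq A] :
    ∃ y, ∀ x, (img T.subst [x]).head? = some y := by
  obtain ⟨f, hf⟩ := returnSubst_head h T.spell_τ
  refine ⟨(img T.levels [f]).head (T.img_levels_ne_nil f), fun x => ?_⟩
  obtain ⟨l, hl, e⟩ := T.q_eq x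
  have hne : img T.τ [l.head hl] ≠ [] := by
    intro h0
    have := hf (l.head hl)
    rw [h0] at this
    simp at this
  rw [img_subst, img_group_singleton, e, head?_img T.levels (x := f) _ (T.img_levels_ne_nil f),
    List.head?_eq_some_head]
  rw [head?_img _ (List.head?_eq_some_head hl) hne, hf]

theorem subst_last (h : CutsAt σ b a) [DecidableEq A] :
    ∃ y, ∀ x, (img T.subst [x]).getLast? = some y := by
  obtain ⟨f, hf⟩ := returnSubst_last h T.spell_τ
  refine ⟨(img T.levels [f]).getLast (T.img_levels_ne_nil f), fun x => ?_⟩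
  obtain ⟨l, hl, e⟩ := T.q_eq x
  have hne : img T.τ [l.getLast hl] ≠ [] := by
    intro h0
    have := hf (l.getLast hl)
    rw [h0] at this
    simp at this
  rw [img_subst, img_group_singleton, e, getLast?_img T.levels (x := f) _ (T.img_levels_ne_nil f),
    List.getLast?_eq_some_getLast]
  rw [getLast?_img _ (List.getLast?_eq_some_getLast hl) hne, hf]

theorem isProper_subst (h : CutsAt σ b a) [DecidableEq A] : IsProper T.subst := by
  obtain ⟨y, hy⟩ := T.subst_head h
  obtain ⟨z, hz⟩ := T.subst_last h
  refine ⟨⟨y, fun x => ?_⟩, ⟨z, fun x => ?_⟩⟩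
  · obtain ⟨t, ht⟩ := List.head?_eq_some_iff.1 (hy x)
    exact ⟨t, ht.symm⟩
  · obtain ⟨t, ht⟩ := List.getLast?_eq_some_iff.1 (hz x)
    exact ⟨t, ht.symm⟩

theorem isSubstitution_subst (h : CutsAt σ b a) [DecidableEq A] : IsSubstitution T.subst := by
  obtain ⟨y, hy⟩ := (T.isProper_subst h).1
  exact ⟨⟨y, hy y⟩, fun x => tendsto_atTop_mono (fun n => T.two_pow_le_length h n x)
    (tendsto_pow_atTop_atTop_of_one_lt one_lt_two)⟩

/-- The image of any position contains all the positions of some return word. From there on the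
iterates follow those of `τ²`, which reach every return word. -/
theorem exists_mem_img_subst_pow [Finite A] [DecidableEq A] (hL : LanguagePrimitive σ)
    (h : CutsAt σ b a) : ∃ N, ∀ n ≥ N, ∀ x y, y ∈ img (T.subst ^ n) [x] := by
  obtain ⟨N, hN⟩ := returnSubst_primitive hL h T.spell_τ
  refine ⟨N + 1, fun n hn x y => ?_⟩
  obtain ⟨r, hr⟩ := T.exists_infix_img_subst h x
  have h1 := img_infix (T.subst ^ (n - 1)) hr
  rw [img_subst_pow_levels] at h1
  have h2 := img_infix T.levels
    (singleton_infix (hN (2 * (n - 1)) (by omega) r (T.e y).1))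
  have h3 := (h2.trans h1).subset (T.mem_img_levels y)
  rwa [← img_pow_one T.subst, ← img_pow_add, Nat.sub_add_cancel (by omega)] at h3

theorem isPrimitiveSubstitution_subst [Finite A] [DecidableEq A] [Fintype B] [DecidableEq B]
    (hL : LanguagePrimitive σ) (h : CutsAt σ b a) : IsPrimitiveSubstitution T.subst := by
  refine ⟨T.isSubstitution_subst h, fun i j => ?_, ?_⟩
  · rw [incidenceMatrix_eq_inc, inc_apply]
    positivity
  · obtain ⟨N, hN⟩ := T.exists_mem_img_subst_pow hL h
    refine ⟨N + 1, by omega, fun i j => ?_⟩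
    rw [← incidenceMatrix_pow, incidenceMatrix_eq_inc, inc_apply]
    exact_mod_cast List.count_pos_iff.2 (hN (N + 1) (by omega) j i)

theorem exists_infix_levels {w : List B} (hw : w ∈ language T.subst) :
    ∃ n r, w <:+: img T.levels (img (T.τ ^ n) [r]) := by
  obtain ⟨n, x, hx⟩ := mem_language.1 hw
  refine ⟨2 * n, (T.e x).1, hx.trans ?_⟩
  rw [← img_subst_pow_levels]
  exact img_infix _ (singleton_infix (T.mem_img_levels x))

theorem map_letter_mem_language {w : List B} (hw : w ∈ language T.subst) :
    w.map T.letter ∈ language σ := by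
  obtain ⟨n, r, h⟩ := T.exists_infix_levels hw
  have h1 := h.map T.letter
  rw [map_letter_levels, img_spell_pow T.spell_τ, img_spell_singleton] at h1
  exact language_infix (language_img n (language_infix r.2.mem ⟨[b], [a], by simp⟩)) h1

theorem exists_map_letter_eq (hL : LanguagePrimitive σ) (h : CutsAt σ b a)
    {w : List A} (hw : w ∈ language σ) : ∃ v ∈ language T.subst, v.map T.letter = w := by
  classical
  obtain ⟨N, hN⟩ := hL w hw
  obtain ⟨r⟩ := exists_returnWord h
  obtain ⟨x, -⟩ := List.exists_mem_of_ne_nil _ (T.img_levels_ne_nil r)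
  obtain ⟨s, hs⟩ := T.exists_infix_img_subst h x
  have h1 := img_infix (T.subst ^ N) hs
  rw [← img_pow_one T.subst, ← img_pow_add] at h1
  have h2 : w <:+: (img (T.subst ^ N) (img T.levels [s])).map T.letter := by
    rw [img_subst_pow_levels, map_letter_levels, img_spell_pow T.spell_τ, img_spell_singleton]
    exact (hN (2 * N) (by omega) a).trans
      (img_infix _ (singleton_infix (List.mem_of_mem_head? s.2.head)))
  obtain ⟨v, hv, rfl⟩ := List.infix_map_iff.1 h2
  exact ⟨v, ⟨N + 1, x, hv.trans h1⟩, rfl⟩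

end ReturnTower

end Tower

/-! ### Letter-to-letter maps between subshifts -/

section Conjugacy

variable {A B : Type*}

theorem factor_add (x : ℤ → A) (i : ℤ) (m n : ℕ) :
    factor x i (m + n) = factor x i m ++ factor x (i + m) n := by
  simp only [factor, List.ofFn_add]
  congr 1
  refine congrArg List.ofFn (funext fun k => ?_)
  simp [add_assoc]

theorem factor_map (f : B → A) (y : ℤ → B) (i : ℤ) (n : ℕ) :
    factor (fun j => f (y j)) i n = (factor y i n).map f := by
  simp only [factor, List.map_ofFn]
  rfl

theorem factor_eq_iff {x y : ℤ → A} {i : ℤ} {n : ℕ} :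
    factor x i n = factor y i n ↔ ∀ k : ℕ, k < n → x (i + k) = y (i + k) := by
  rw [factor, factor, List.ofFn_inj, funext_iff]
  exact ⟨fun h k hk => h ⟨k, hk⟩, fun h k => h k k.2⟩

theorem factor_infix {x : ℤ → A} {i j : ℤ} {m n : ℕ} (h : j ≤ i) (h' : i + n ≤ j + m) :
    factor x i n <:+: factor x j m := by
  obtain ⟨p, hp⟩ := Int.eq_ofNat_of_zero_le (sub_nonneg.2 h)
  obtain ⟨s, hs⟩ := Int.eq_ofNat_of_zero_le (sub_nonneg.2 h')
  have e : m = (p + n) + s := by omega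
  have e' : i = j + p := by omega
  rw [e, factor_add, factor_add, e']
  exact ⟨_, _, rfl⟩

theorem exists_factor_eq (v : List A) (i : ℤ) (h : v ≠ []) :
    ∃ y : ℤ → A, factor y i v.length = v := by
  refine ⟨fun j => v.getD (j - i).toNat (v.head h), ?_⟩
  refine List.ext_getElem (by simp [factor]) fun k h1 h2 => ?_
  simp [factor]

variable [TopologicalSpace A] [DiscreteTopology A] [TopologicalSpace B] [DiscreteTopology B]

/-- A letter-to-letter map that is onto between languages is onto between the subshifts. -/
theorem exists_mem_substSubshift [Finite B] {σ : Monoid.End (FreeMonoid A)}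
    {ξ : Monoid.End (FreeMonoid B)} (f : B → A)
    (hf : ∀ w ∈ language σ, ∃ v ∈ language ξ, v.map f = w) {x : ℤ → A}
    (hx : x ∈ (substSubshift σ).carrier) :
    ∃ y ∈ (substSubshift ξ).carrier, (fun j => f (y j)) = x := by
  -- The sequences that lift `x` correctly on the window `[-n, n]`. They form a decreasing sequence
  -- of nonempty compact sets, and a common point is a lift of `x`.
  let C : ℕ → Set (ℤ → B) := fun n =>
    {y | factor y (-n) (2 * n + 1) ∈ {v | v ∈ language ξ ∧ v.map f = factor x (-n) (2 * n + 1)}}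
  have hclosed : ∀ n, IsClosed (C n) := fun n => isClosed_factor_mem _ _ _
  have hne : ∀ n, (C n).Nonempty := by
    intro n
    obtain ⟨v, hv, hvf⟩ := hf _ (hx (-n) (2 * n + 1))
    have hl : v.length = 2 * n + 1 := by
      have := congrArg List.length hvf
      simpa [factor] using this
    obtain ⟨y, hy⟩ := exists_factor_eq v (-n) (by rintro rfl; simp at hl)
    rw [hl] at hy
    exact ⟨y, by change _ ∧ _; rw [hy]; exact ⟨hv, hvf⟩⟩
  have hanti : ∀ n, C (n + 1) ⊆ C n := by
    intro n y hy
    have hy1 : factor y (-(n + 1 : ℕ)) (2 * (n + 1) + 1) ∈ language ξ := hy.1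
    have hy2 : (factor y (-(n + 1 : ℕ)) (2 * (n + 1) + 1)).map f =
      factor x (-(n + 1 : ℕ)) (2 * (n + 1) + 1) := hy.2
    refine ⟨language_infix hy1 (factor_infix (by omega) (by omega)), ?_⟩
    rw [← factor_map, factor_eq_iff] at hy2 ⊢
    intro k hk
    have := hy2 (k + 1) (by omega)
    have e : -((n + 1 : ℕ) : ℤ) + ((k + 1 : ℕ) : ℤ) = -n + k := by omega
    rwa [e] at this
  obtain ⟨y, hy⟩ := IsCompact.nonempty_iInter_of_sequence_nonempty_isCompact_isClosed C hanti hne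
    (hclosed 0).isCompact hclosed
  rw [Set.mem_iInter] at hy
  refine ⟨y, fun i n => ?_, funext fun j => ?_⟩
  · exact language_infix (hy (i.natAbs + n)).1 (factor_infix (by omega) (by omega))
  · have h1 := (hy j.natAbs).2
    rw [← factor_map, factor_eq_iff] at h1
    have := h1 (j + j.natAbs).toNat (by omega)
    have e : -(j.natAbs : ℤ) + ((j + j.natAbs).toNat : ℤ) = j := by omega
    rwa [e] at this

/-- A letter-to-letter map that is onto between languages and injective on the subshift is a
conjugacy. -/
theorem conjugate_of_letter_map [Finite B] {σ : Monoid.End (FreeMonoid A)}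
    {ξ : Monoid.End (FreeMonoid B)} (f : B → A)
    (hf : ∀ w ∈ language σ, ∃ v ∈ language ξ, v.map f = w)
    (hf' : ∀ v ∈ language ξ, v.map f ∈ language σ)
    (hinj : ∀ y ∈ (substSubshift ξ).carrier, ∀ y' ∈ (substSubshift ξ).carrier,
      (fun j => f (y j)) = (fun j => f (y' j)) → y = y') :
    Conjugate (substSubshift σ) (substSubshift ξ) := by
  have hmem : ∀ y ∈ (substSubshift ξ).carrier, (fun j => f (y j)) ∈ (substSubshift σ).carrier := by
    intro y hy i n
    rw [factor_map]
    exact hf' _ (hy i n)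
  let F : (substSubshift ξ).carrier → (substSubshift σ).carrier :=
    fun y => ⟨fun j => f (y.1 j), hmem y.1 y.2⟩
  have hF : Continuous F := by
    refine Continuous.subtype_mk (continuous_pi fun j => ?_) _
    exact continuous_of_discreteTopology.comp ((continuous_apply j).comp continuous_subtype_val)
  have hbij : Function.Bijective F := by
    constructor
    · intro y y' h
      exact Subtype.ext (hinj _ y.2 _ y'.2 (congrArg Subtype.val h))
    · intro x
      obtain ⟨y, hy, e⟩ := exists_mem_substSubshift f hf x.2
      exact ⟨⟨y, hy⟩, Subtype.ext e⟩
  have : CompactSpace (substSubshift ξ).carrier :=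
    isCompact_iff_compactSpace.1 (substSubshift ξ).isClosed.isCompact
  let G : (substSubshift ξ).carrier ≃ₜ (substSubshift σ).carrier :=
    Continuous.homeoOfEquivCompactToT2 (f := Equiv.ofBijective F hbij) hF
  refine ⟨G.symm, fun x => ?_⟩
  rw [Homeomorph.symm_apply_eq]
  obtain ⟨y, rfl⟩ := G.surjective x
  rw [Homeomorph.symm_apply_apply]
  rfl

end Conjugacy

/-! ### Recovering the positions from the letters -/

section TowerConjugacy

variable {A B : Type*} {σ : Monoid.End (FreeMonoid A)} {b a : A}

namespace ReturnTower

variable (T : ReturnTower σ b a B)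

/-- The return word of a position. -/
def ret (x : B) : ReturnWord σ b a := (T.e x).1

/-- The index of a position in its return word. -/
def pos (x : B) : ℕ := (T.e x).2.1

theorem pos_lt (x : B) : T.pos x < (T.ret x).1.length := (T.e x).2.2

theorem letter_eq (x : B) : T.letter x = (T.ret x).1[T.pos x]'(T.pos_lt x) := rfl

theorem ext_pos {x y : B} (h : T.ret x = T.ret y) (h' : T.pos x = T.pos y) : x = y := by
  apply T.e.injective
  unfold ret pos at *
  rcases hx : T.e x with ⟨r, p⟩
  rcases hy : T.e y with ⟨s, q⟩
  rw [hx, hy] at h h'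
  obtain rfl : r = s := h
  congr
  exact Fin.ext h'

/-- The relation between consecutive positions. -/
def Next (x y : B) : Prop :=
  (T.ret y = T.ret x ∧ T.pos y = T.pos x + 1) ∨
    (T.pos x + 1 = (T.ret x).1.length ∧ T.pos y = 0)

theorem ret_symm (r : ReturnWord σ b a) (p : Fin r.1.length) : T.ret (T.e.symm ⟨r, p⟩) = r := by
  rw [ret, Equiv.apply_symm_apply]

theorem pos_symm (r : ReturnWord σ b a) (p : Fin r.1.length) : T.pos (T.e.symm ⟨r, p⟩) = p := by
  rw [pos, Equiv.apply_symm_apply]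

theorem pos_head_levels (l : List (ReturnWord σ b a)) (x : B)
    (h : x ∈ (img T.levels l).head?) : T.pos x = 0 := by
  rcases l with _ | ⟨r, l⟩
  · simp at h
  · rw [img_cons, List.head?_append_of_ne_nil _ (T.img_levels_ne_nil r), img_levels_singleton,
      List.head?_eq_getElem?] at h
    obtain ⟨h0, rfl⟩ := List.getElem?_eq_some_iff.1 h
    rw [List.getElem_ofFn, pos_symm]

theorem isChain_levels (l : List (ReturnWord σ b a)) : (img T.levels l).IsChain T.Next := by
  induction l with
  | nil => simp
  | cons r l ih =>
    rw [img_cons, List.isChain_append]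
    refine ⟨?_, ih, fun x hx y hy => Or.inr ⟨?_, T.pos_head_levels l y hy⟩⟩
    · rw [img_levels_singleton, List.isChain_iff_getElem]
      intro i hi
      left
      simp [ret_symm, pos_symm]
    · rw [img_levels_singleton, List.getLast?_eq_getElem?] at hx
      obtain ⟨h0, rfl⟩ := List.getElem?_eq_some_iff.1 hx
      rw [List.getElem_ofFn, pos_symm, ret_symm]
      simp only [List.length_ofFn] at h0 ⊢
      omega

variable [TopologicalSpace B] [DiscreteTopology B] {T}

theorem next_of_mem {y : ℤ → B} (hy : y ∈ (substSubshift T.subst).carrier) (i : ℤ) :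
    T.Next (y i) (y (i + 1)) := by
  obtain ⟨n, r, h⟩ := T.exists_infix_levels (hy i 2)
  have h1 := (T.isChain_levels _).infix h
  simpa [factor] using h1

theorem pos_sub {y : ℤ → B} (hy : y ∈ (substSubshift T.subst).carrier) (i : ℤ) (k : ℕ)
    (hk : k ≤ T.pos (y i)) :
    T.ret (y (i - k)) = T.ret (y i) ∧ T.pos (y (i - k)) = T.pos (y i) - k := by
  induction k with
  | zero => simp
  | succ k ih =>
    obtain ⟨h1, h2⟩ := ih (by omega)
    have h3 := next_of_mem hy (i - (k + 1 : ℕ))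
    have e : i - ((k + 1 : ℕ) : ℤ) + 1 = i - k := by push_cast; ring
    rw [e] at h3
    rcases h3 with h3 | h3
    · exact ⟨h3.1.symm.trans h1, by omega⟩
    · omega

theorem pos_add {y : ℤ → B} (hy : y ∈ (substSubshift T.subst).carrier) (i : ℤ) (k : ℕ)
    (hk : T.pos (y i) + k < (T.ret (y i)).1.length) :
    T.ret (y (i + k)) = T.ret (y i) ∧ T.pos (y (i + k)) = T.pos (y i) + k := by
  induction k with
  | zero => simp
  | succ k ih =>
    obtain ⟨h1, h2⟩ := ih (by omega)
    have h3 := next_of_mem hy (i + k)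
    have e : i + (k : ℤ) + 1 = i + ((k + 1 : ℕ) : ℤ) := by push_cast; ring
    rw [e] at h3
    rcases h3 with h3 | h3
    · exact ⟨h3.1.trans h1, by omega⟩
    · rw [h1, h2] at h3
      omega

/-- Return words begin with `a`, end with `b` and contain no `ba`. So the cuts of the letter
sequence are exactly the places where a new return word starts. -/
theorem pos_eq_zero_iff {y : ℤ → B} (hy : y ∈ (substSubshift T.subst).carrier) (i : ℤ) :
    T.pos (y i) = 0 ↔ T.letter (y (i - 1)) = b ∧ T.letter (y i) = a := by
  have h := next_of_mem hy (i - 1)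
  rw [sub_add_cancel] at h
  constructor
  · intro h0
    rcases h with h | h
    · omega
    · constructor
      · have h1 := (T.ret (y (i - 1))).2.last
        rw [List.getLast?_eq_getElem?] at h1
        obtain ⟨_, h2⟩ := List.getElem?_eq_some_iff.1 h1
        rw [letter_eq]
        refine Eq.trans ?_ h2
        congr 1
        omega
      · have h1 := (T.ret (y i)).2.head
        rw [List.head?_eq_getElem?] at h1
        obtain ⟨_, h2⟩ := List.getElem?_eq_some_iff.1 h1
        rw [letter_eq]
        refine Eq.trans ?_ h2
        congr 1
  · rintro ⟨hb, ha⟩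
    rcases h with ⟨h1, h2⟩ | h
    · have hc := List.isChain_iff_getElem.1 (T.ret (y (i - 1))).2.chain (T.pos (y (i - 1)))
        (by rw [← h2, ← h1]; exact T.pos_lt _)
      refine absurd ⟨hb, Eq.trans ?_ ha⟩ hc
      rw [letter_eq]
      simp only [h1, h2]
    · exact h.2

/-- Going back `pos (y i)` steps reaches the start of a return word in `y`, hence a cut, hence a
start in `y'` as well. That is too early if `y'` has the larger position. -/
theorem pos_le_of_eq {y y' : ℤ → B} (hy : y ∈ (substSubshift T.subst).carrier)
    (hy' : y' ∈ (substSubshift T.subst).carrier)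
    (h : (fun j => T.letter (y j)) = fun j => T.letter (y' j)) (i : ℤ) :
    T.pos (y' i) ≤ T.pos (y i) := by
  by_contra! hlt
  have h1 := (pos_sub hy i (T.pos (y i)) le_rfl).2
  have h2 := (pos_sub hy' i (T.pos (y i)) hlt.le).2
  rw [Nat.sub_self, pos_eq_zero_iff hy] at h1
  have e1 := congrFun h (i - T.pos (y i) - 1)
  have e2 := congrFun h (i - T.pos (y i))
  rw [e1, e2, ← pos_eq_zero_iff hy'] at h1
  omega

theorem length_ret_le_of_eq {y y' : ℤ → B} (hy : y ∈ (substSubshift T.subst).carrier)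
    (hy' : y' ∈ (substSubshift T.subst).carrier)
    (h : (fun j => T.letter (y j)) = fun j => T.letter (y' j)) (i : ℤ)
    (hp : T.pos (y i) = T.pos (y' i)) :
    (T.ret (y' i)).1.length ≤ (T.ret (y i)).1.length := by
  by_contra! hlt
  have hl := T.pos_lt (y i)
  set k := (T.ret (y i)).1.length - 1 - T.pos (y i) with hk
  obtain ⟨h1, h2⟩ := pos_add hy i k (by omega)
  have h3 := (pos_add hy' i (k + 1) (by omega)).2
  have h4 : T.pos (y (i + (k + 1 : ℕ))) = 0 := by
    have h5 := next_of_mem hy (i + k)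
    have e : i + (k : ℤ) + 1 = i + ((k + 1 : ℕ) : ℤ) := by push_cast; ring
    rw [e] at h5
    rcases h5 with ⟨h5, h6⟩ | h5
    · have := T.pos_lt (y (i + (k + 1 : ℕ)))
      rw [h5, h6, h1, h2] at this
      omega
    · exact h5.2
  rw [pos_eq_zero_iff hy] at h4
  have e1 := congrFun h (i + (k + 1 : ℕ) - 1)
  have e2 := congrFun h (i + (k + 1 : ℕ))
  rw [e1, e2, ← pos_eq_zero_iff hy'] at h4
  omega

theorem letter_sub_add {y : ℤ → B} (hy : y ∈ (substSubshift T.subst).carrier) (i : ℤ) (k : ℕ)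
    (hk : k < (T.ret (y i)).1.length) :
    T.letter (y (i - T.pos (y i) + k)) = (T.ret (y i)).1[k] := by
  obtain ⟨h1, h2⟩ := pos_sub hy i (T.pos (y i)) le_rfl
  obtain ⟨h3, h4⟩ := pos_add hy (i - T.pos (y i)) k (by rw [h1, h2]; omega)
  rw [letter_eq]
  simp only [h3, h4, h1, h2, Nat.sub_self, Nat.zero_add]

/-- The cuts determine the position and the length of the current return word at each index, and the
letters between the cuts then determine the word itself. -/
theorem eq_of_letter_eq {y y' : ℤ → B} (hy : y ∈ (substSubshift T.subst).carrier)
    (hy' : y' ∈ (substSubshift T.subst).carrier)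
    (h : (fun j => T.letter (y j)) = fun j => T.letter (y' j)) : y = y' := by
  funext i
  have hp : T.pos (y i) = T.pos (y' i) :=
    le_antisymm (pos_le_of_eq hy' hy h.symm i) (pos_le_of_eq hy hy' h i)
  have hl : (T.ret (y i)).1.length = (T.ret (y' i)).1.length :=
    le_antisymm (length_ret_le_of_eq hy' hy h.symm i hp.symm) (length_ret_le_of_eq hy hy' h i hp)
  refine T.ext_pos (Subtype.ext (List.ext_getElem hl fun k h1 h2 => ?_)) hp
  rw [← letter_sub_add hy i k h1, ← letter_sub_add hy' i k h2, ← hp]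
  exact congrFun h _

theorem conjugate [Finite B] [TopologicalSpace A] [DiscreteTopology A]
    (hL : LanguagePrimitive σ) (h : CutsAt σ b a) :
    Conjugate (substSubshift σ) (substSubshift T.subst) :=
  conjugate_of_letter_map T.letter (fun _ hw => T.exists_map_letter_eq hL h hw)
    (fun _ hv => T.map_letter_mem_language hv) fun _ hy _ hy' e => eq_of_letter_eq hy hy' e

end ReturnTower

end TowerConjugacy

/-! ### Eigenvalues of integer matrices and Pisot numbers -/

section Eigenvalues

variable {n : Type*} [Fintype n] [DecidableEq n]

theorem aeval_charpoly_eq_zero_iff (M : Matrix n n ℤ) (z : ℂ) :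
    aeval z M.charpoly = 0 ↔
      ∃ x ≠ 0, (M.map (Int.castRingHom ℂ)).mulVec x = z • x := by
  have h1 : aeval z M.charpoly = (Matrix.scalar n z - M.map (Int.castRingHom ℂ)).det := by
    rw [← Matrix.eval_charpoly, Matrix.charpoly_map, eval_map, aeval_def]
    rfl
  rw [h1, ← Matrix.exists_mulVec_eq_zero_iff]
  refine exists_congr fun x => and_congr_right fun _ => ?_
  rw [Matrix.sub_mulVec, sub_eq_zero, eq_comm]
  simp [Matrix.scalar_apply, ← Matrix.smul_one_eq_diagonal, Matrix.smul_mulVec]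

theorem aeval_charpoly_eq_zero_iff_mem_spectrum (M : Matrix n n ℤ) (z : ℂ) :
    aeval z M.charpoly = 0 ↔ z ∈ spectrum ℂ (M.map (Int.castRingHom ℂ)) := by
  rw [Matrix.mem_spectrum_iff_isRoot_charpoly, Matrix.charpoly_map, IsRoot.def, eval_map,
    aeval_def]
  rfl

theorem aeval_charpoly_pow_iff (M : Matrix n n ℤ) {k : ℕ} (hk : 0 < k) (z : ℂ) :
    aeval z (M ^ k).charpoly = 0 ↔ ∃ w, aeval w M.charpoly = 0 ∧ w ^ k = z := by
  have h : (M ^ k).map (Int.castRingHom ℂ) = (M.map (Int.castRingHom ℂ)) ^ k :=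
    map_pow (Int.castRingHom ℂ).mapMatrix M k
  rw [aeval_charpoly_eq_zero_iff_mem_spectrum, h, spectrum.map_pow_of_pos _ hk, Set.mem_image]
  simp only [aeval_charpoly_eq_zero_iff_mem_spectrum]

theorem norm_multiset_sum_le (s : Multiset ℂ) (h : ∀ z ∈ s, ‖z‖ ≤ 1) : ‖s.sum‖ ≤ s.card := by
  induction s using Multiset.induction_on with
  | empty => simp
  | cons z s ih =>
    rw [Multiset.sum_cons, Multiset.card_cons, Nat.cast_add, Nat.cast_one, add_comm]
    have h1 := ih fun w hw => h w (Multiset.mem_cons_of_mem hw)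
    have h2 := h z (Multiset.mem_cons_self z s)
    exact (norm_add_le _ _).trans (by linarith)

theorem norm_multiset_prod_le_one (s : Multiset ℂ) (h : ∀ z ∈ s, ‖z‖ ≤ 1) : ‖s.prod‖ ≤ 1 := by
  induction s using Multiset.induction_on with
  | empty => simp
  | cons z s ih =>
    rw [Multiset.prod_cons, norm_mul]
    have h1 := ih fun w hw => h w (Multiset.mem_cons_of_mem hw)
    exact mul_le_one₀ (h z (Multiset.mem_cons_self z s)) (norm_nonneg _) h1

/-- If no eigenvalue of an integer matrix lies outside the unit disc, the trace is at most the
size. -/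
theorem trace_le_card (M : Matrix n n ℤ) (h : ∀ z : ℂ, aeval z M.charpoly = 0 → ‖z‖ ≤ 1) :
    M.trace ≤ Fintype.card n := by
  have h1 : ((M.trace : ℤ) : ℂ) = (M.map (Int.castRingHom ℂ)).charpoly.roots.sum := by
    rw [← Matrix.trace_eq_sum_roots_charpoly]
    simp [Matrix.trace]
  have h2 : ‖((M.trace : ℤ) : ℂ)‖ ≤ (M.map (Int.castRingHom ℂ)).charpoly.roots.card := by
    rw [h1]
    refine norm_multiset_sum_le _ fun z hz => h z ?_
    rw [aeval_charpoly_eq_zero_iff_mem_spectrum, Matrix.mem_spectrum_iff_isRoot_charpoly]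
    exact (mem_roots'.1 hz).2
  have h3 : (M.map (Int.castRingHom ℂ)).charpoly.roots.card ≤ Fintype.card n :=
    (card_roots' _).trans (Matrix.charpoly_natDegree_eq_dim _).le
  have h4 : ‖((M.trace : ℤ) : ℂ)‖ ≤ (Fintype.card n : ℝ) := h2.trans (by exact_mod_cast h3)
  rw [Complex.norm_intCast] at h4
  exact_mod_cast (le_abs_self _).trans h4

/-- An integer monic polynomial with a root `β > 1` all of whose other roots `z` satisfy
`0 < |z| < 1` has the same roots as the minimal polynomial of `β`, a Pisot number. -/
theorem isPisotNumber_of_monic {P : ℤ[X]} (hP : P.Monic) {β : ℝ} (hβ : 1 < β)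
    (hroot : aeval (β : ℂ) P = 0)
    (hother : ∀ z : ℂ, aeval z P = 0 → z ≠ (β : ℂ) → 0 < ‖z‖ ∧ ‖z‖ < 1) :
    IsPisotNumber β ∧ ∀ z : ℂ, aeval z P = 0 → aeval z (minpoly ℚ β) = 0 := by
  have hrootR : aeval β P = 0 := (aeval_algebraMap_eq_zero_iff ℂ β P).1 hroot
  have hint : IsIntegral ℤ β := ⟨P, hP, by rwa [aeval_def] at hrootR⟩
  refine ⟨⟨hβ, hint, fun z hz hne => (hother z ?_ hne).2⟩, fun z hz => ?_⟩
  · have h1 : minpoly ℚ β ∣ P.map (algebraMap ℤ ℚ) := minpoly.dvd _ _ (by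
      rwa [aeval_map_algebraMap])
    have h2 := aeval_eq_zero_of_dvd_aeval_eq_zero h1 hz
    rwa [aeval_map_algebraMap] at h2
  · have hzint : IsIntegral ℤ z := ⟨P, hP, by rwa [aeval_def] at hz⟩
    have hdvd : minpoly ℤ z ∣ P := minpoly.isIntegrallyClosed_dvd hzint hz
    -- Otherwise all conjugates of `z` have modulus strictly between `0` and `1`. Their product is,
    -- up to sign, the constant coefficient: a nonzero integer of modulus less than `1`.
    have hβf : aeval (β : ℂ) (minpoly ℤ z) = 0 := by
      by_contra hβf
      have hr : ∀ w ∈ ((minpoly ℤ z).map (algebraMap ℤ ℂ)).roots, 0 < ‖w‖ ∧ ‖w‖ < 1 := by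
        intro w hw
        have hw' : aeval w (minpoly ℤ z) = 0 := by
          have := (mem_roots'.1 hw).2
          rwa [IsRoot.def, eval_map_algebraMap] at this
        refine hother w (aeval_eq_zero_of_dvd_aeval_eq_zero hdvd hw') ?_
        rintro rfl
        exact hβf hw'
      have hmon : ((minpoly ℤ z).map (algebraMap ℤ ℂ)).Monic := (minpoly.monic hzint).map _
      have hzr : z ∈ ((minpoly ℤ z).map (algebraMap ℤ ℂ)).roots := by
        rw [mem_roots hmon.ne_zero, IsRoot.def, eval_map_algebraMap, minpoly.aeval]
      have hc := (IsAlgClosed.splits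
        ((minpoly ℤ z).map (algebraMap ℤ ℂ))).coeff_zero_eq_prod_roots_of_monic hmon
      obtain ⟨s, hs⟩ := Multiset.exists_cons_of_mem hzr
      rw [hs] at hc hr
      have hn := congrArg norm hc
      rw [coeff_map, norm_mul, norm_pow, norm_neg, norm_one, one_pow, one_mul, Multiset.prod_cons,
        norm_mul] at hn
      have hpos : 0 < ‖z‖ * ‖s.prod‖ := by
        refine mul_pos (hr z (Multiset.mem_cons_self _ _)).1 (norm_pos_iff.2 ?_)
        refine Multiset.prod_ne_zero fun h0 => ?_
        simpa using (hr 0 (Multiset.mem_cons_of_mem h0)).1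
      have hlt : ‖z‖ * ‖s.prod‖ < 1 :=
        (mul_le_of_le_one_right (norm_nonneg _) (norm_multiset_prod_le_one s fun w hw =>
          (hr w (Multiset.mem_cons_of_mem hw)).2.le)).trans_lt
            (hr z (Multiset.mem_cons_self _ _)).2
      rw [← hn, eq_intCast, Complex.norm_intCast] at hpos hlt
      have h1 : 0 < |(minpoly ℤ z).coeff 0| := by exact_mod_cast hpos
      have h2 : |(minpoly ℤ z).coeff 0| < 1 := by exact_mod_cast hlt
      omega
    have hQ : minpoly ℚ z = (minpoly ℤ z).map (algebraMap ℤ ℚ) :=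
      minpoly.isIntegrallyClosed_eq_field_fractions' ℚ hzint
    have hβz : aeval β (minpoly ℚ z) = 0 := by
      rw [hQ, aeval_map_algebraMap]
      exact (aeval_algebraMap_eq_zero_iff ℂ β _).1 hβf
    have hzQ : IsIntegral ℚ z := hzint.tower_top
    rw [← minpoly.eq_of_irreducible_of_monic (minpoly.irreducible hzQ) hβz (minpoly.monic hzQ)]
    exact minpoly.aeval _ _

end Eigenvalues

/-! ### Block counts and the kernel of the spelling matrix -/

section BlockCounts

variable {A : Type*}

/-- The sum of a function over the pairs of consecutive letters of a word. -/
def pairSum (f : A → A → ℤ) : List A → ℤ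
  | [] => 0
  | [_] => 0
  | c :: d :: w => f c d + pairSum f (d :: w)

variable [DecidableEq A]

/-- The number of blocks equal to `s` in the image of a word is a sum over its letters, corrected
by bounded terms for the pairs of consecutive letters. -/
theorem exists_count_blocks_img [Fintype A] {σ : Monoid.End (FreeMonoid A)} {b a : A}
    (h : CutsAt σ b a) : ∃ D : A → A → List A → Set.Icc (-2 : ℤ) 2, ∀ s w, w ≠ [] →
      ((blocks b a (img σ w)).count s : ℤ) =
        ∑ c, ((blocks b a (img σ [c])).count s : ℤ) * (w.count c : ℤ) +
          pairSum (fun c d => (D c d s : ℤ)) w := by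
  -- Each image is split at its last cut when it stands on the left of a pair and at its first cut
  -- when it stands on the right, so that the defect of a pair involves cut-free words only.
  choose p q hpq hp hq hqc using fun c => exists_last_cut (h.infix_img c)
  choose p' q' hpq' hp' hq' hpc' using fun c => exists_first_cut (h.infix_img c)
  have hqe : ∀ c, q c ≠ [] := fun c h0 => by simpa [h0] using hq c
  have hpe : ∀ c, p' c ≠ [] := fun c h0 => by simpa [h0] using hp' c
  have hqe' : ∀ c, q' c ≠ [] := fun c h0 => by simpa [h0] using hq' c
  refine ⟨fun c d s => ⟨blockDefect b a s (q c) (p' d),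
    blockDefect_mem s (hqc c) (hpc' d) (hqe c) (hpe d)⟩, fun s w hw => ?_⟩
  induction w with
  | nil => exact absurd rfl hw
  | cons c w ih =>
    rcases w with _ | ⟨d, w⟩
    · simp [pairSum, List.count_singleton]
    · have ih := ih (by simp)
      have e1 : img σ (d :: w) = p' d ++ (q' d ++ img σ w) := by
        rw [img_cons, hpq', List.append_assoc]
      have e2 := count_blocks_append s (p c) (q c) (p' d) (q' d ++ img σ w) (hp c) (hq c) (hp' d)
        (by rw [List.head?_append_of_ne_nil _ (hqe' d)]; exact hq' d)
      rw [img_cons, pairSum, hpq c]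
      rw [← e1, ih] at e2
      rw [e2]
      simp only [List.count_cons (l := d :: w), Nat.cast_add, mul_add, Finset.sum_add_distrib]
      simp [hpq c]
      ring

end BlockCounts

section Kernel

variable {A : Type*} [Fintype A] [DecidableEq A] {σ : Monoid.End (FreeMonoid A)} {b a : A}

/-- On the vectors killed by the incidence matrix of the spelling morphism, two distinct powers of
the incidence matrix of the induced substitution agree. -/
theorem exists_pow_eq_on_ker [Fintype (ReturnWord σ b a)] (h : CutsAt σ b a)
    {τ : Monoid.End (FreeMonoid (ReturnWord σ b a))}
    (hτ : ∀ l, img (spell σ b a) (img τ l) = img σ (img (spell σ b a) l)) {k : ℕ} (hk : 0 < k) :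
    ∃ i j : ℕ, i ≠ j ∧ ∀ y : ReturnWord σ b a → ℂ,
      ((inc (spell σ b a)).map (Int.castRingHom ℂ)).mulVec y = 0 →
      ((inc (τ ^ (k * i))).map (Int.castRingHom ℂ)).mulVec y =
        ((inc (τ ^ (k * j))).map (Int.castRingHom ℂ)).mulVec y := by
  -- The exponents are `k * (i + 1)` because only positive powers are known to create cuts.
  choose D hD using fun i : ℕ => exists_count_blocks_img (h.pow (n := k * (i + 1)) (by positivity))
  -- The tables of pair coefficients, restricted to return words `s`, form a finite set, so two
  -- exponents share the same table.
  obtain ⟨i, j, hij, hDij⟩ := Finite.exists_ne_map_eq_of_infinite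
    fun i : ℕ => fun (c d : A) (s : ReturnWord σ b a) => D i c d s.1
  have key : ∀ (i : ℕ) (y : ReturnWord σ b a → ℂ),
      ((inc (spell σ b a)).map (Int.castRingHom ℂ)).mulVec y = 0 → ∀ s,
      ((inc (τ ^ (k * (i + 1)))).map (Int.castRingHom ℂ)).mulVec y s =
        ∑ r, (pairSum (fun c d => (D i c d s.1 : ℤ)) r.1 : ℂ) * y r := by
    intro i y hy s
    -- Being in the kernel says that the letter counts weighted by `y` vanish. This removes the part
    -- of the block counts that is linear in them.
    have hy' : ∀ c, ∑ r : ReturnWord σ b a, ((r.1.count c : ℤ) : ℂ) * y r = 0 := by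
      intro c
      have := congrFun hy c
      simpa [Matrix.mulVec, dotProduct, inc_apply, img_spell_singleton] using this
    simp only [Matrix.mulVec, dotProduct, Matrix.map_apply, inc_returnSubst_pow hτ]
    simp only [hD i s.1 _ (IsReturnWord.ne_nil (Subtype.prop _)), map_add, map_sum, map_mul,
      add_mul, Finset.sum_add_distrib, Finset.sum_mul]
    rw [Finset.sum_comm]
    have hz : ∀ c : A, ∑ r : ReturnWord σ b a, (Int.castRingHom ℂ)
        ((blocks b a (img (σ ^ (k * (i + 1))) [c])).count s.1 : ℤ) *
          (Int.castRingHom ℂ) (r.1.count c : ℤ) * y r = 0 := by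
      intro c
      simp only [mul_assoc, ← Finset.mul_sum]
      have := hy' c
      simp only [eq_intCast] at this ⊢
      rw [this, mul_zero]
    rw [Finset.sum_eq_zero fun c _ => hz c, zero_add]
    rfl
  refine ⟨i + 1, j + 1, by omega, fun y hy => funext fun s => ?_⟩
  rw [key i y hy, key j y hy]
  have : (fun c d => (D i c d s.1 : ℤ)) = fun c d => (D j c d s.1 : ℤ) := by
    funext c d
    exact congrArg Subtype.val (congrFun (congrFun (congrFun hDij c) d) s)
  rw [this]

end Kernel

/-! ### The spectrum of the tower substitution -/

section TowerEigenvalues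

variable {A B : Type*} [Fintype A] [DecidableEq A] [Fintype B] [DecidableEq B]
  {σ : Monoid.End (FreeMonoid A)} {b a : A}

namespace ReturnTower

theorem map_mul_intCast {l m n : Type*} [Fintype m] (M : Matrix l m ℤ) (N : Matrix m n ℤ) :
    (M * N).map (Int.castRingHom ℂ) =
      M.map (Int.castRingHom ℂ) * N.map (Int.castRingHom ℂ) :=
  Matrix.map_mul

theorem pow_mulVec_eq {n : Type*} [Fintype n] [DecidableEq n] {M : Matrix n n ℂ} {y : n → ℂ}
    {z : ℂ} (h : M.mulVec y = z • y) (i : ℕ) : (M ^ i).mulVec y = z ^ i • y := by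
  induction i with
  | zero => simp
  | succ i ih => rw [pow_succ, ← Matrix.mulVec_mulVec, h, Matrix.mulVec_smul, ih, smul_smul,
      pow_succ, mul_comm]

/-- A nonzero eigenvalue of the tower substitution is an eigenvalue of the square of the original
one or a root of unity. -/
theorem aeval_charPoly_subst (T : ReturnTower σ b a B) (hL : LanguagePrimitive σ)
    (h : CutsAt σ b a) {z : ℂ} (hz : aeval z (charPoly T.subst) = 0) :
    aeval z (charPoly (σ ^ 2)) = 0 ∨ z = 0 ∨ ∃ n : ℕ, 0 < n ∧ z ^ n = 1 := by
  have := finite_returnWord hL h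
  cases nonempty_fintype (ReturnWord σ b a)
  by_cases hz0 : z = 0
  · exact Or.inr (Or.inl hz0)
  obtain ⟨x, hx, hMx⟩ := (aeval_charpoly_eq_zero_iff _ z).1 hz
  have hfac : incidenceMatrix T.subst = inc T.levels * inc T.group := inc_comp _ _
  have hτ2 : inc (T.τ ^ 2) = inc T.group * inc T.levels := by
    rw [← inc_comp]
    ext s r
    rw [inc_apply, inc_apply, img_comp, img_group_levels, img_pow_add T.τ 1 1, img_pow_one,
      img_pow_one]
  have hσ2 : inc (spell σ b a) * inc (T.τ ^ 2) = inc (σ ^ 2) * inc (spell σ b a) := by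
    ext s r
    rw [Matrix.mul_apply, Matrix.mul_apply]
    have h1 := count_img (spell σ b a) (img (T.τ ^ 2) [r]) s
    have h2 := count_img (σ ^ 2) (img (spell σ b a) [r]) s
    rw [img_spell_pow T.spell_τ, h2] at h1
    exact h1.symm
  rw [hfac, map_mul_intCast, ← Matrix.mulVec_mulVec] at hMx
  -- The usual passage from eigenvectors of `LG` to those of `GL`: `Gx` is nonzero because `L(Gx) =
  -- z • x` and `z ≠ 0`.
  set y := ((inc T.group).map (Int.castRingHom ℂ)).mulVec x with hy
  have hy0 : y ≠ 0 := by
    intro h0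
    rw [h0, Matrix.mulVec_zero] at hMx
    exact (smul_ne_zero hz0 hx) hMx.symm
  have hτy : ((inc (T.τ ^ 2)).map (Int.castRingHom ℂ)).mulVec y = z • y := by
    rw [hτ2, map_mul_intCast, ← Matrix.mulVec_mulVec, hMx, Matrix.mulVec_smul]
  by_cases hw : ((inc (spell σ b a)).map (Int.castRingHom ℂ)).mulVec y = 0
  · right; right
    obtain ⟨i, j, hij, hk⟩ := exists_pow_eq_on_ker h T.spell_τ (k := 2) two_pos
    have hpow : ∀ i : ℕ, ((inc (T.τ ^ (2 * i))).map (Int.castRingHom ℂ)).mulVec y =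
        z ^ i • y := by
      intro i
      rw [pow_mul, inc_pow (T.τ ^ 2) i]
      have e : ((inc (T.τ ^ 2)) ^ i).map (Int.castRingHom ℂ) =
          ((inc (T.τ ^ 2)).map (Int.castRingHom ℂ)) ^ i :=
        map_pow (Int.castRingHom ℂ).mapMatrix _ _
      rw [e, pow_mulVec_eq hτy]
    have h1 := hk y hw
    rw [hpow, hpow] at h1
    have h2 : z ^ i = z ^ j := smul_left_injective ℂ hy0 h1
    have key : ∀ i j : ℕ, i < j → z ^ i = z ^ j → ∃ n : ℕ, 0 < n ∧ z ^ n = 1 := by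
      intro i j hlt e
      refine ⟨j - i, by omega, mul_left_cancel₀ (pow_ne_zero i hz0) ?_⟩
      rw [← pow_add, Nat.add_sub_cancel' hlt.le, mul_one, e]
    rcases lt_or_gt_of_ne hij with hlt | hlt
    · exact key i j hlt h2
    · exact key j i hlt h2.symm
  · left
    refine (aeval_charpoly_eq_zero_iff _ z).2 ⟨_, hw, ?_⟩
    rw [incidenceMatrix_eq_inc, Matrix.mulVec_mulVec, ← map_mul_intCast, ← hσ2, map_mul_intCast,
      ← Matrix.mulVec_mulVec, hτy, Matrix.mulVec_smul]

theorem length_le_count_img {X Y F : Type*} [DecidableEq Y]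
    [FunLike F (FreeMonoid X) (FreeMonoid Y)]
    [MonoidHomClass F (FreeMonoid X) (FreeMonoid Y)] (f : F) {y : Y}
    (h : ∀ x, y ∈ img f [x]) (l : List X) : l.length ≤ (img f l).count y := by
  induction l with
  | nil => simp
  | cons x l ih =>
    rw [img_cons, List.count_append, List.length_cons]
    have := List.count_pos_iff.2 (h x)
    omega

/-- The tower substitution has an eigenvalue outside of the unit disc. -/
theorem exists_one_lt_norm (T : ReturnTower σ b a B) (hL : LanguagePrimitive σ)
    (h : CutsAt σ b a) : ∃ z : ℂ, aeval z (charPoly T.subst) = 0 ∧ 1 < ‖z‖ := by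
  by_contra! hle
  obtain ⟨N, hN⟩ := T.exists_mem_img_subst_pow hL h
  obtain ⟨r⟩ := exists_returnWord h
  obtain ⟨x, -⟩ := List.exists_mem_of_ne_nil _ (T.img_levels_ne_nil r)
  -- If no eigenvalue had modulus above `1`, all traces of powers would be at most `j`. But `ξ^j(x)`
  -- has at least `2 ^ j` letters, each of whose images under `ξ^(N + 1)` contains `x`, so one
  -- diagonal entry alone is at least `2 ^ j > j`.
  set j := Fintype.card B with hj
  have h1 : (inc (T.subst ^ ((N + 1) + j))).trace ≤ Fintype.card B := by
    refine trace_le_card _ fun z hz => ?_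
    rw [inc_pow, aeval_charpoly_pow_iff _ (by omega)] at hz
    obtain ⟨w, hw, rfl⟩ := hz
    rw [norm_pow]
    exact pow_le_one₀ (norm_nonneg _) (hle w hw)
  have h2 : inc (T.subst ^ ((N + 1) + j)) x x ≤ (inc (T.subst ^ ((N + 1) + j))).trace :=
    Finset.single_le_sum (f := fun i => inc (T.subst ^ ((N + 1) + j)) i i)
      (fun i _ => by rw [inc_apply]; positivity) (Finset.mem_univ x)
  have h3 : 2 ^ j ≤ (img (T.subst ^ ((N + 1) + j)) [x]).count x := by
    rw [img_pow_add]
    exact (T.two_pow_le_length h j x).trans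
      (length_le_count_img _ (fun y => hN (N + 1) (by omega) y x) _)
  have h4 : j < 2 ^ j := Nat.lt_two_pow_self
  rw [inc_apply] at h2
  omega

end ReturnTower

/-- If the eigenvalues of the square of the original substitution are those of Pisot type, then the
tower substitution is of weakly irreducible Pisot type. -/
theorem ReturnTower.isWeaklyIrreduciblePisotType
    (T : ReturnTower σ b a B) (hL : LanguagePrimitive σ) (h : CutsAt σ b a) {β : ℝ} (hβ : 1 < β)
    (hroot : aeval (β : ℂ) (charPoly (σ ^ 2)) = 0)
    (hother : ∀ z : ℂ, aeval z (charPoly (σ ^ 2)) = 0 → z ≠ (β : ℂ) → 0 < ‖z‖ ∧ ‖z‖ < 1) :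
    IsWeaklyIrreduciblePisotType T.subst := by
  obtain ⟨hpisot, hmin⟩ := isPisotNumber_of_monic (Matrix.charpoly_monic _) hβ hroot hother
  have hunit : ∀ z : ℂ, (z = 0 ∨ ∃ n : ℕ, 0 < n ∧ z ^ n = 1) → ‖z‖ ≤ 1 := by
    rintro z (rfl | ⟨n, hn, hz⟩)
    · simp
    · exact (Complex.norm_eq_one_of_pow_eq_one hz hn.ne').le
  -- Every possible eigenvalue other than `β` lies in the closed unit disc, so the one found outside
  -- it is `β`.
  have hβroot : aeval (β : ℂ) (charPoly T.subst) = 0 := by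
    obtain ⟨z, hz, hz1⟩ := T.exists_one_lt_norm hL h
    rcases T.aeval_charPoly_subst hL h hz with h1 | h1
    · by_cases hzβ : z = β
      · rwa [← hzβ]
      · exact absurd (hother z h1 hzβ).2 hz1.not_gt
    · exact absurd (hunit z h1) hz1.not_ge
  refine ⟨T.isPrimitiveSubstitution_subst hL h, β, hpisot, hβroot, ?_, ?_, ?_⟩
  · intro z hz hne
    rcases T.aeval_charPoly_subst hL h hz with h1 | h1
    · exact (hother z h1 hne).2.trans hβ
    · exact (hunit z h1).trans_lt hβ
  · intro z hz
    have h1 : minpoly ℚ β ∣ (charPoly T.subst).map (algebraMap ℤ ℚ) := minpoly.dvd _ _ (by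
      rw [aeval_map_algebraMap]
      exact (aeval_algebraMap_eq_zero_iff ℂ β _).1 hβroot)
    have h2 := aeval_eq_zero_of_dvd_aeval_eq_zero h1 hz
    rwa [aeval_map_algebraMap] at h2
  · intro z hz
    exact (T.aeval_charPoly_subst hL h hz).imp_left (hmin z)

end TowerEigenvalues

end PisotSubst

/-! ### The main theorem -/

theorem mainTheorem3 {A : Type*} [Fintype A] [DecidableEq A]
    [TopologicalSpace A] [DiscreteTopology A]
    (σ : Monoid.End (FreeMonoid A))
    (hσ : PisotSubst.IsPisotType σ) (hap : PisotSubst.IsAperiodic σ) :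
    ∃ (m : ℕ) (ξ : Monoid.End (FreeMonoid (Fin m))),
      PisotSubst.IsPrimitiveSubstitution ξ ∧
      PisotSubst.IsProper ξ ∧
      PisotSubst.IsWeaklyIrreduciblePisotType ξ ∧
      PisotSubst.Conjugate (PisotSubst.substSubshift σ) (PisotSubst.substSubshift ξ) := by
  obtain ⟨hprim, β, hβ, hroot, hother⟩ := hσ
  obtain ⟨k, hk, a, b, hcut⟩ := PisotSubst.exists_cutsAt hprim
  have hL := hprim.languagePrimitive.pow hk
  have := PisotSubst.finite_returnWord hL hcut
  cases nonempty_fintype (PisotSubst.ReturnWord (σ ^ k) b a)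
  obtain ⟨T⟩ := PisotSubst.exists_returnTower hcut (Fintype.equivFin
    (Σ r : PisotSubst.ReturnWord (σ ^ k) b a, Fin r.1.length)).symm
  have hk2 : 0 < k * 2 := by omega
  -- The exponent `k * 2` combines the power that creates cuts with the two applications of `τ` in
  -- the tower. Raising to it preserves the Pisot conditions, and the dominant root becomes `β ^ (k
  -- * 2)`.
  have hpow : ∀ z : ℂ, Polynomial.aeval z (PisotSubst.charPoly ((σ ^ k) ^ 2)) = 0 ↔
      ∃ w, Polynomial.aeval w (PisotSubst.charPoly σ) = 0 ∧ w ^ (k * 2) = z := by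
    intro z
    rw [← pow_mul, PisotSubst.charPoly, PisotSubst.incidenceMatrix_pow]
    exact PisotSubst.aeval_charpoly_pow_iff _ hk2 z
  refine ⟨_, T.subst, T.isPrimitiveSubstitution_subst hL hcut, T.isProper_subst hcut,
    T.isWeaklyIrreduciblePisotType hL hcut (β := β ^ (k * 2))
      (one_lt_pow₀ hβ hk2.ne') ((hpow _).2 ⟨β, hroot, by push_cast; rfl⟩) ?_, ?_⟩
  · intro z hz hne
    obtain ⟨w, hw, rfl⟩ := (hpow z).1 hz
    have hwβ : w ≠ β := by
      rintro rfl
      exact hne (by push_cast; rfl)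
    obtain ⟨h1, h2⟩ := hother w hw hwβ
    rw [norm_pow]
    exact ⟨pow_pos h1 _, pow_lt_one₀ h1.le h2 hk2.ne'⟩
  · rw [← PisotSubst.substSubshift_pow hprim.languagePrimitive hk]
    exact T.conjugate hL hcut
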